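/- Throughout, C*-algebras and *-homomorphisms are unital, and ideals of a C*-algebra are closed and two-sided. Let $C$ be a C*-algebra and let $X\subseteq C$ be a linear subspace that contains the unit of $C$ and generates $C$ as a C*-algebra, $C=C^*(X)$. Give each $M_n(X)$ the norm inherited from the C*-algebra $M_n(C)$; a linear map $\varphi$ from $X$ into a C*-algebra $B$ is called a unital complete isometry if $\varphi(1)=1$ and $\|[\varphi(x_{ij})]\|_{M_n(B)}=\|[x_{ij}]\|_{M_n(C)}$ for all $n\ge 1$ and all $[x_{ij}]\in M_n(X)$. An ideal $J$ of $C$ is called a boundary ideal for $X$ if the restriction to $X$ of the quotient map $q_J\colon C\to C/J$ is a unital complete isometry. A C*-cover of $X$ is a pair $(B,j)$, where $B$ is a C*-algebra, $j\colon X\to B$ is a unital complete isometry, and $B=C^*(j(X))$. Then there is a largest boundary ideal $I$ for $X$ in $C$ (the Šilov ideal of $X$ in $C$): $I$ is a boundary ideal and contains every boundary ideal. Moreover $(C/I,\,q_I|_X)$ is the C*-envelope of $X$: it is a C*-cover of $X$, and for every C*-cover $(B,j)$ of $X$ there is a unique surjective *-homomorphism $\Phi\colon B\to C/I$ with $\Phi(j(x))=q_I(x)$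 for all $x\in X$. -/

import Mathlib

universe v u

noncomputable section

/-! ### The quotient of a C*-algebra by a closed two-sided ideal -/

namespace CStarQuotient

variable {C : Type*} [CStarAlgebra C]

/-- A closed two-sided ideal contains local approximate units. -/
theorem exists_approx (I : Ideal C) [I.IsTwoSided] {i k : C} (hi : star i * i = k) (hk : k ∈ I)
    {ε : ℝ} (hε : 0 < ε) :
    ∃ e ∈ I, star e = e ∧ ‖1 - e‖ ≤ 1 ∧ ‖i * (1 - e)‖ ≤ ε := by
  let _ := CStarAlgebra.spectralOrder C
  have _ := CStarAlgebra.spectralOrderedRing C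
  have hk0 : 0 ≤ k := hi ▸ star_mul_self_nonneg i
  have hksa : IsSelfAdjoint k := hk0.isSelfAdjoint
  set δ : ℝ := ε ^ 2 with hδdef
  have hδ : 0 < δ := by positivity
  have hspec : ∀ x ∈ spectrum ℝ k, 0 ≤ x := fun x hx => spectrum_nonneg_of_nonneg hk0 hx
  let f : ℝ → ℝ := fun t => δ / (δ + t)
  let g : ℝ → ℝ := fun t => 1 / (δ + t)
  have hg : ContinuousOn g (spectrum ℝ k) := by
    refine ContinuousOn.div continuousOn_const (by fun_prop) fun x hx => ?_
    have := hspec x hx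
    positivity
  have hf : ContinuousOn f (spectrum ℝ k) := by
    refine ContinuousOn.div continuousOn_const (by fun_prop) fun x hx => ?_
    have := hspec x hx
    positivity
  have hfg : cfc f k + cfc g k * k = 1 := by
    have h1 : cfc g k * k = cfc (fun t => g t * t) k := by
      conv_lhs => rw [← cfc_id ℝ k (ha := hksa)]
      rw [cfc_id ℝ k (ha := hksa)]
      rw [cfc_mul g (fun t => t) k hg (by fun_prop), cfc_id' ℝ k]
    rw [h1, ← cfc_add k f (fun t => g t * t) hf (by fun_prop), ← cfc_one ℝ k]
    refine cfc_congr fun x hx => ?_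
    have := hspec x hx
    have : δ + x ≠ 0 := by positivity
    simp only [f, g, Pi.one_apply]
    field_simp
  have he : (1 : C) - cfc g k * k = cfc f k := by rw [← hfg]; abel
  have hfsa : star (cfc f k) = cfc f k := (cfc_predicate f k : IsSelfAdjoint (cfc f k))
  refine ⟨cfc g k * k, I.mul_mem_left _ hk, ?_, ?_, ?_⟩
  · have : cfc g k * k = 1 - cfc f k := by rw [← hfg]; abel
    rw [this, star_sub, star_one, hfsa]
  · rw [he]
    refine norm_cfc_le zero_le_one fun x hx => ?_
    have := hspec x hx
    rw [Real.norm_of_nonneg (by positivity)]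
    exact (div_le_one (by positivity)).2 (by linarith)
  · rw [he]
    refine le_of_sq_le_sq ?_ hε.le
    rw [sq ‖_‖, ← CStarRing.norm_star_mul_self, star_mul, hfsa]
    have h2 : cfc f k * star i * (i * cfc f k) = cfc (fun t => f t * t * f t) k := by
      rw [cfc_mul (fun t => f t * t) f k (by fun_prop) hf,
        cfc_mul f (fun t => t) k hf (by fun_prop), cfc_id' ℝ k, ← hi]
      simp only [mul_assoc]
    rw [h2]
    refine norm_cfc_le hδ.le fun x hx => ?_
    have := hspec x hx
    rw [Real.norm_of_nonneg (by positivity)]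
    have h3 : f x * x * f x = δ * ((δ * x) / (δ + x) ^ 2) := by
      simp only [f]
      field_simp
    rw [h3]
    refine mul_le_of_le_one_right hδ.le ((div_le_one (by positivity)).2 ?_)
    nlinarith

theorem star_mem (I : Ideal C) [I.IsTwoSided] [hI : IsClosed (I : Set C)] {a : C} (ha : a ∈ I) :
    star a ∈ I := by
  have : star a ∈ closure (I : Set C) := by
    refine Metric.mem_closure_iff.2 fun ε hε => ?_
    obtain ⟨e, heI, hes, -, hle⟩ :=
      exists_approx I (i := a) rfl (I.mul_mem_left _ ha) (half_pos hε)
    refine ⟨e * star a, I.mul_mem_right _ heI, ?_⟩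
    have : star a - e * star a = star (a * (1 - e)) := by
      rw [star_mul, star_sub, star_one, hes, sub_mul, one_mul]
    rw [dist_eq_norm, this, norm_star]
    linarith
  rwa [hI.closure_eq] at this

variable (I : Ideal C) [I.IsTwoSided] [hI : IsClosed (I : Set C)]

instance instStar : Star (C ⧸ I) where
  star := Quotient.map' star fun a b h => by
    rw [Submodule.quotientRel_def] at h ⊢
    rw [← star_sub]
    exact star_mem I h

theorem star_mk (a : C) :
    star (Ideal.Quotient.mk I a) = Ideal.Quotient.mk I (star a) := rfl

instance instStarRing : StarRing (C ⧸ I) where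
  star_involutive x := by
    obtain ⟨a, rfl⟩ := Ideal.Quotient.mk_surjective x
    rw [star_mk, star_mk, star_star]
  star_mul x y := by
    obtain ⟨a, rfl⟩ := Ideal.Quotient.mk_surjective x
    obtain ⟨b, rfl⟩ := Ideal.Quotient.mk_surjective y
    rw [← map_mul, star_mk, star_mul, map_mul, star_mk, star_mk]
  star_add x y := by
    obtain ⟨a, rfl⟩ := Ideal.Quotient.mk_surjective x
    obtain ⟨b, rfl⟩ := Ideal.Quotient.mk_surjective y
    rw [← map_add, star_mk, star_add, map_add, star_mk, star_mk]

instance instStarModule : StarModule ℂ (C ⧸ I) where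
  star_smul c x := by
    obtain ⟨a, rfl⟩ := Ideal.Quotient.mk_surjective x
    change Ideal.Quotient.mk I (star (c • a)) = Ideal.Quotient.mk I (star c • star a)
    rw [star_smul]

theorem exists_lift (x : C ⧸ I) {ε : ℝ} (hε : 0 < ε) :
    ∃ a : C, Ideal.Quotient.mk I a = x ∧ ‖a‖ < ‖x‖ + ε :=
  Submodule.Quotient.norm_mk_lt x hε

theorem norm_mk_le (a : C) : ‖Ideal.Quotient.mk I a‖ ≤ ‖a‖ :=
  Submodule.Quotient.norm_mk_le (S := I) a

theorem norm_mul_le' (x y : C ⧸ I) : ‖x * y‖ ≤ ‖x‖ * ‖y‖ := by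
  have key : ∀ ε : ℝ, 0 < ε → ‖x * y‖ ≤ (‖x‖ + ε) * (‖y‖ + ε) := fun ε hε => by
    obtain ⟨a, rfl, ha⟩ := exists_lift I x hε
    obtain ⟨b, rfl, hb⟩ := exists_lift I y hε
    rw [← map_mul]
    refine (norm_mk_le I _).trans ((norm_mul_le a b).trans ?_)
    exact mul_le_mul ha.le hb.le (norm_nonneg _) (by positivity)
  have hlim : Filter.Tendsto (fun ε : ℝ => (‖x‖ + ε) * (‖y‖ + ε)) (nhdsWithin 0 (Set.Ioi 0))
      (nhds ((‖x‖ + 0) * (‖y‖ + 0))) :=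
    (Continuous.tendsto (by fun_prop) 0).mono_left nhdsWithin_le_nhds
  simp only [add_zero] at hlim
  refine ge_of_tendsto hlim ?_
  filter_upwards [self_mem_nhdsWithin] with ε hε using key ε hε

theorem norm_mul_self_le' (x : C ⧸ I) : ‖x‖ * ‖x‖ ≤ ‖star x * x‖ := by
  obtain ⟨a, rfl⟩ := Ideal.Quotient.mk_surjective x
  refine le_of_forall_pos_le_add fun ε hε => ?_
  obtain ⟨b, hb, hbn⟩ := exists_lift I (star (Ideal.Quotient.mk I a) * Ideal.Quotient.mk I a)
    (half_pos hε)
  have hi : b - star a * a ∈ I := by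
    rw [← Ideal.Quotient.eq, hb, star_mk, map_mul]
  obtain ⟨e, heI, hes, he1, hle⟩ :=
    exists_approx I (i := b - star a * a) rfl (I.mul_mem_left _ hi) (half_pos hε)
  have hmk : Ideal.Quotient.mk I a = Ideal.Quotient.mk I (a * (1 - e)) := by
    rw [Ideal.Quotient.eq]
    have : a - a * (1 - e) = a * e := by rw [mul_sub, mul_one]; abel
    rw [this]
    exact I.mul_mem_left _ heI
  have h1 : ‖Ideal.Quotient.mk I a‖ ≤ ‖a * (1 - e)‖ := by
    rw [hmk]; exact norm_mk_le I _
  have hs : star (1 - e) = 1 - e := by rw [star_sub, star_one, hes]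
  have h2 : ‖a * (1 - e)‖ * ‖a * (1 - e)‖ ≤ ‖b‖ + ε / 2 := by
    rw [← CStarRing.norm_star_mul_self, star_mul, hs]
    have : (1 - e) * star a * (a * (1 - e))
        = (1 - e) * (b * (1 - e)) - (1 - e) * ((b - star a * a) * (1 - e)) := by
      noncomm_ring
    rw [this]
    refine (norm_sub_le _ _).trans (add_le_add ?_ ?_)
    · calc ‖(1 - e) * (b * (1 - e))‖ ≤ ‖1 - e‖ * (‖b‖ * ‖1 - e‖) :=
            (norm_mul_le _ _).trans (by gcongr; exact norm_mul_le _ _)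
        _ ≤ 1 * (‖b‖ * 1) := by gcongr
        _ = ‖b‖ := by ring
    · calc ‖(1 - e) * ((b - star a * a) * (1 - e))‖ ≤ ‖1 - e‖ * ‖(b - star a * a) * (1 - e)‖ :=
            norm_mul_le _ _
        _ ≤ 1 * (ε / 2) := by gcongr
        _ = ε / 2 := one_mul _
  have h3 := mul_le_mul h1 h1 (norm_nonneg _) (norm_nonneg _)
  linarith

/-- The quotient `C ⧸ I` of a C*-algebra by a closed two-sided ideal, with the quotient norm
`‖a + I‖ = inf {‖a + b‖ | b ∈ I}` of Mathlib and the involution `(a + I)* = a* + I`. -/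
instance instCStarAlgebra : CStarAlgebra (C ⧸ I) where
  __ := Ideal.Quotient.ring I
  __ := (Submodule.Quotient.normedAddCommGroup I : NormedAddCommGroup (C ⧸ I))
  __ := (Ideal.Quotient.algebra ℂ : Algebra ℂ (C ⧸ I))
  __ := (Submodule.Quotient.completeSpace I : CompleteSpace (C ⧸ I))
  __ := instStarRing I
  norm_mul_le := norm_mul_le' I
  norm_mul_self_le := norm_mul_self_le' I
  norm_smul_le := (Submodule.Quotient.normedSpace I ℂ : NormedSpace ℂ (C ⧸ I)).norm_smul_le
  star_smul := (instStarModule I).star_smul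

/-- The canonical *-epimorphism `q_I : C → C ⧸ I`. -/
def mk : C →⋆ₐ[ℂ] C ⧸ I where
  toFun := Ideal.Quotient.mk I
  map_one' := rfl
  map_mul' _ _ := rfl
  map_zero' := rfl
  map_add' _ _ := rfl
  commutes' _ := rfl
  map_star' _ := rfl

end CStarQuotient

/-! ### Unital operator spaces, their C*-covers and the C*-envelope -/

namespace OperatorSpace

/-- The C*-norm of `M_n(A)`, for a unital C*-algebra `A`. -/
def matrixNorm {A : Type*} [CStarAlgebra A] {n : ℕ} (M : Matrix (Fin n) (Fin n) A) : ℝ :=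
  letI := CStarAlgebra.spectralOrder A
  haveI := CStarAlgebra.spectralOrderedRing A
  ‖CStarMatrix.ofMatrix M‖

variable {A : Type*} [CStarAlgebra A]

/-- `X` is a unital operator space in `A`: a linear subspace that contains the unit of `A`. It
carries the matrix norms that `M_n(X)` inherits from `M_n(A)`. -/
def IsUnital (X : Submodule ℂ A) : Prop := (1 : A) ∈ X

/-- `φ : X → B` is a unital complete isometry (ucis map). -/
structure IsUCIS (X : Submodule ℂ A) {B : Type*} [CStarAlgebra B] (φ : X →ₗ[ℂ] B) : Prop where
  map_one : ∀ e : X, (e : A) = 1 → φ e = 1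
  isometric : ∀ (n : ℕ) (M : Matrix (Fin n) (Fin n) X),
    matrixNorm (M.map φ) = matrixNorm (M.map ((↑) : X → A))

/-- The unital C*-algebra `B` is generated, as a C*-algebra, by the set `S`. -/
def Generates {B : Type*} [CStarAlgebra B] (S : Set B) : Prop :=
  (StarAlgebra.adjoin ℂ S).topologicalClosure = ⊤

/-- `(B, j)` is a C*-cover of `X`: `j` is a ucis map and `B = C*(j(X))`. -/
structure IsCStarCover (X : Submodule ℂ A) {B : Type*} [CStarAlgebra B] (j : X →ₗ[ℂ] B) :
    Prop where
  ucis : IsUCIS X j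
  generates : Generates (Set.range j)

/-- `(E, ι)` is the C*-envelope of `X`: it is a C*-cover of `X`, and for every C*-cover `(B, j)`
there is a unique *-epimorphism `Φ : B → E` with `Φ (j x) = ι x` for all `x ∈ X`. The covers range
over the universe `v`, which is arbitrary. -/
structure IsCStarEnvelope {A : Type u} [CStarAlgebra A] (X : Submodule ℂ A)
    {E : Type*} [CStarAlgebra E] (ι : X →ₗ[ℂ] E) : Prop where
  isCover : IsCStarCover X ι
  existsUnique_epi : ∀ (B : Type v) [CStarAlgebra B] (j : X →ₗ[ℂ] B), IsCStarCover X j →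
    ∃! Φ : B →⋆ₐ[ℂ] E, Function.Surjective Φ ∧ ∀ x : X, Φ (j x) = ι x

/-- The restriction to `X` of the quotient map `q_I : A → A ⧸ I`. -/
def quotientMap (X : Submodule ℂ A) (I : Ideal A) [I.IsTwoSided] [IsClosed (I : Set A)] :
    X →ₗ[ℂ] A ⧸ I :=
  (CStarQuotient.mk I).toAlgHom.toLinearMap ∘ₗ X.subtype

/-- `I` is a boundary ideal for `X`: a (closed, two-sided) ideal of `A` such that the restriction
to `X` of the quotient map `q_I : A → A ⧸ I` is a ucis map. -/
def IsBoundaryIdeal (X : Submodule ℂ A) (I : Ideal A) : Prop :=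
  ∃ (_ : I.IsTwoSided) (_ : IsClosed (I : Set A)), IsUCIS X (quotientMap X I)

/-- `I` is the Šilov ideal of `X` in `A`: the largest boundary ideal. -/
def IsSilovIdeal (X : Submodule ℂ A) (I : Ideal A) : Prop :=
  IsGreatest {J : Ideal A | IsBoundaryIdeal X J} I

end OperatorSpace

end

/-! The argument follows Hamana's route through rigidity. Represent `C` faithfully on `H` by `π`
(GNS) and consider the semigroup of unital complete contractions of `B(H)` that fix `π(X)`. It is
compact for pointwise weak operator convergence, and right multiplication by a fixed element is
continuous. Hence it has a minimal closed left ideal, and averaging powers shows that any `φ` in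
this ideal satisfies `φγφ = φ` for every `γ` in the semigroup (`FixingMap.exists_rigid`). In
particular `φ` is idempotent.

By the Schwarz inequality, `φ(r φ(a)) = φ(r a)` for `r` in the range of `φ` (Choi–Effros,
`map_mul_map`). So `ker φ` is stable under left multiplication by `π(X)` and `π(X)*`, hence by
`π(C)`, and `I = {c | φ(π c) = 0}` is an ideal. It is a boundary ideal: `φ ∘ π` vanishes on `I` and
agrees with `π` on `X`, so any lift of a matrix over `X + I` is at least as large in norm as the
matrix over `X`.

For maximality let `J` be a boundary ideal. Arveson's theorem (`IsUCCOn.exists_extension`) extends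
the inverse of `q_J|X` to `Θ : C/J → B(H)`, and then `Θ ∘ q_J ∘ π⁻¹` to `γ` on `B(H)`. Rigidity
makes `φγ` an idempotent with the same range as `φ`. Two such idempotents agree on products of
elements of their range, hence on `π(C)`, so `c ∈ J` gives `φ(π c) = φ(Θ(q_J c)) = 0`.

For the envelope, a cover `B` is compared with `C` inside the C*-algebra `D ⊆ C × B` generated by
the graph of `j`. The kernels of both projections of `D` are boundary ideals, so they lie in the
Šilov ideal of `D`; this forces `D → C → C/I` to factor through `B`. -/

noncomputable section

namespace OperatorSpace

/-! ### Matrix norms and *-homomorphisms -/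

section Matrices

variable {A B : Type*} [CStarAlgebra A] [CStarAlgebra B]

theorem matrixNorm_nonneg {n : ℕ} (M : Matrix (Fin n) (Fin n) A) : 0 ≤ matrixNorm M := by
  let _ := CStarAlgebra.spectralOrder A
  have _ := CStarAlgebra.spectralOrderedRing A
  exact norm_nonneg (CStarMatrix.ofMatrix M)

theorem matrixNorm_map_le (π : A →⋆ₙₐ[ℂ] B) {n : ℕ} (M : Matrix (Fin n) (Fin n) A) :
    matrixNorm (M.map π) ≤ matrixNorm M := by
  let _ := CStarAlgebra.spectralOrder A
  have _ := CStarAlgebra.spectralOrderedRing A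
  let _ := CStarAlgebra.spectralOrder B
  have _ := CStarAlgebra.spectralOrderedRing B
  exact NonUnitalStarAlgHom.norm_apply_le (CStarMatrix.mapₙₐ (n := Fin n) π)
    (CStarMatrix.ofMatrix M)

theorem matrixNorm_map_of_injective (π : A →⋆ₙₐ[ℂ] B) (hπ : Function.Injective π) {n : ℕ}
    (M : Matrix (Fin n) (Fin n) A) : matrixNorm (M.map π) = matrixNorm M := by
  let _ := CStarAlgebra.spectralOrder A
  have _ := CStarAlgebra.spectralOrderedRing A
  let _ := CStarAlgebra.spectralOrder B
  have _ := CStarAlgebra.spectralOrderedRing B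
  exact NonUnitalStarAlgHom.norm_map (CStarMatrix.mapₙₐ (n := Fin n) π)
    (CStarMatrix.map_injective hπ) (CStarMatrix.ofMatrix M)

/-- The map `a ↦ [a]` is an injective *-homomorphism, hence isometric. -/
theorem matrixNorm_fin_one (a : A) :
    matrixNorm (Matrix.of fun _ _ : Fin 1 => a) = ‖a‖ := by
  let _ := CStarAlgebra.spectralOrder A
  have _ := CStarAlgebra.spectralOrderedRing A
  let π : A →⋆ₙₐ[ℂ] CStarMatrix (Fin 1) (Fin 1) A :=
    { toFun := fun a => CStarMatrix.ofMatrix (Matrix.of fun _ _ => a)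
      map_smul' := fun _ _ => rfl
      map_zero' := rfl
      map_add' := fun _ _ => rfl
      map_mul' := fun _ _ => by ext; simp [CStarMatrix.mul_apply]
      map_star' := fun _ => rfl }
  exact NonUnitalStarAlgHom.norm_map π
    (fun _ _ h => congrArg (fun M : CStarMatrix (Fin 1) (Fin 1) A => M 0 0) h) a

end Matrices

/-! ### Operator matrices acting on `Hⁿ` -/

section Amplification

variable {H : Type*} [NormedAddCommGroup H] [InnerProductSpace ℂ H]

/-- The operator on `Hⁿ` given by an `n × n` matrix of operators on `H`. -/
def matrixOperator {n : ℕ} (T : Matrix (Fin n) (Fin n) (H →L[ℂ] H)) :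
    PiLp 2 (fun _ : Fin n => H) →L[ℂ] PiLp 2 (fun _ : Fin n => H) :=
  (PiLp.continuousLinearEquiv 2 ℂ (fun _ : Fin n => H)).symm.toContinuousLinearMap ∘L
    ContinuousLinearMap.pi fun i => ∑ j, T i j ∘L PiLp.proj 2 (fun _ : Fin n => H) j

theorem matrixOperator_apply {n : ℕ} (T : Matrix (Fin n) (Fin n) (H →L[ℂ] H))
    (ξ : PiLp 2 (fun _ : Fin n => H)) (i : Fin n) :
    matrixOperator T ξ i = ∑ j, T i j (ξ j) := by
  simp [matrixOperator]

theorem inner_matrixOperator {n : ℕ} (T : Matrix (Fin n) (Fin n) (H →L[ℂ] H))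
    (ξ η : PiLp 2 (fun _ : Fin n => H)) :
    inner ℂ η (matrixOperator T ξ) = ∑ i, ∑ j, inner ℂ (η i) (T i j (ξ j)) := by
  simp [PiLp.inner_apply, matrixOperator_apply, inner_sum]

variable [CompleteSpace H]

/-- Matrices of operators on `H` act on `Hⁿ` by a *-homomorphism. -/
def matrixOperatorHom (n : ℕ) : CStarMatrix (Fin n) (Fin n) (H →L[ℂ] H) →⋆ₙₐ[ℂ]
    (PiLp 2 (fun _ : Fin n => H) →L[ℂ] PiLp 2 (fun _ : Fin n => H)) where
  toFun T := matrixOperator (CStarMatrix.ofMatrix.symm T)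
  map_smul' c T := by
    ext ξ i
    simp [matrixOperator_apply, Finset.smul_sum]
  map_zero' := by
    ext ξ i
    simp [matrixOperator_apply]
  map_add' S T := by
    ext ξ i
    simp [matrixOperator_apply, Finset.sum_add_distrib]
  map_mul' S T := by
    ext ξ i
    change _ = matrixOperator (CStarMatrix.ofMatrix.symm S)
      (matrixOperator (CStarMatrix.ofMatrix.symm T) ξ) i
    simp only [matrixOperator_apply, CStarMatrix.ofMatrix_symm_apply, CStarMatrix.mul_apply,
      sum_apply, map_sum]
    rw [Finset.sum_comm]
    rfl
  map_star' T := by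
    rw [ContinuousLinearMap.star_eq_adjoint, ContinuousLinearMap.eq_adjoint_iff]
    intro ξ η
    rw [inner_matrixOperator, ← inner_conj_symm, inner_matrixOperator, map_sum, Finset.sum_comm]
    simp_rw [map_sum]
    refine Finset.sum_congr rfl fun i _ => Finset.sum_congr rfl fun j _ => ?_
    rw [inner_conj_symm, CStarMatrix.ofMatrix_symm_apply, CStarMatrix.ofMatrix_symm_apply,
      CStarMatrix.star_apply, ContinuousLinearMap.star_eq_adjoint,
      ContinuousLinearMap.adjoint_inner_left]

/-- The action on `Hⁿ` is an injective *-homomorphism, hence isometric. Matrix norms over `B(H)` can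
therefore be tested on vectors. -/
theorem norm_matrixOperator {n : ℕ} (T : Matrix (Fin n) (Fin n) (H →L[ℂ] H)) :
    ‖matrixOperator T‖ = matrixNorm T := by
  let _ := CStarAlgebra.spectralOrder (H →L[ℂ] H)
  have _ := CStarAlgebra.spectralOrderedRing (H →L[ℂ] H)
  refine NonUnitalStarAlgHom.norm_map (matrixOperatorHom (H := H) n) (fun S T h => ?_)
    (CStarMatrix.ofMatrix T)
  ext i j x
  have := congrArg (fun U => U (WithLp.toLp 2 (Pi.single j x)) i) h
  simpa [matrixOperatorHom, matrixOperator_apply, Pi.single_apply, apply_ite] using this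

theorem norm_sum_inner_le {n : ℕ} (T : Matrix (Fin n) (Fin n) (H →L[ℂ] H))
    (ξ η : PiLp 2 (fun _ : Fin n => H)) :
    ‖∑ i, ∑ j, inner ℂ (η i) (T i j (ξ j))‖ ≤ matrixNorm T * ‖ξ‖ * ‖η‖ := by
  rw [← inner_matrixOperator, ← norm_matrixOperator, mul_comm]
  exact (norm_inner_le_norm _ _).trans
    (mul_le_mul_of_nonneg_left ((matrixOperator T).le_opNorm ξ) (norm_nonneg η))

theorem matrixNorm_le_of_forall_inner {n : ℕ} (T : Matrix (Fin n) (Fin n) (H →L[ℂ] H)) {r : ℝ}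
    (hr : 0 ≤ r)
    (h : ∀ ξ η : PiLp 2 (fun _ : Fin n => H),
      ‖∑ i, ∑ j, inner ℂ (η i) (T i j (ξ j))‖ ≤ r * ‖ξ‖ * ‖η‖) :
    matrixNorm T ≤ r := by
  rw [← norm_matrixOperator]
  refine ContinuousLinearMap.opNorm_le_bound _ hr fun ξ => ?_
  -- Testing against `η = Tξ` turns the form bound into `‖Tξ‖² ≤ r ‖ξ‖ ‖Tξ‖`.
  have h1 := h ξ (matrixOperator T ξ)
  rw [← inner_matrixOperator, inner_self_eq_norm_sq_to_K] at h1
  by_contra! h2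
  have h3 : 0 < ‖matrixOperator T ξ‖ := lt_of_le_of_lt (by positivity) h2
  have h4 := mul_lt_mul_of_pos_right h2 h3
  simp only [norm_pow, RCLike.norm_ofReal, abs_norm] at h1
  nlinarith

end Amplification

/-! ### Unital contractive functionals are positive -/

section Functionals

variable {D : Type*} [CStarAlgebra D]

/-- For real `t`, `(Im f(a) + t)² ≤ ‖a + it‖² ≤ ‖a‖² + t²`, so `2t Im f(a)` stays bounded by `‖a‖²`
for all `t`, which forces `Im f(a) = 0`. -/
theorem im_eq_zero_of_contractive (f : D →ₗ[ℂ] ℂ) (hf : ∀ d, ‖f d‖ ≤ ‖d‖) (h1 : f 1 = 1)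
    {a : D} (ha : IsSelfAdjoint a) : (f a).im = 0 := by
  have : Nontrivial D := ⟨⟨1, 0, fun h => by simp [h] at h1⟩⟩
  have key : ∀ t : ℝ, 2 * (f a).im * t ≤ ‖a‖ ^ 2 := fun t => by
    have h2 := hf (a + algebraMap ℂ D (t * Complex.I))
    have h3 : ‖a + algebraMap ℂ D (t * Complex.I)‖ ^ 2 ≤ ‖a‖ ^ 2 + t ^ 2 := by
      have h4 : star (a + algebraMap ℂ D (t * Complex.I)) * (a + algebraMap ℂ D (t * Complex.I))
          = a * a + algebraMap ℂ D (t ^ 2) := by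
        have h5 : algebraMap ℂ D (t * Complex.I) * algebraMap ℂ D (t * Complex.I)
            = - algebraMap ℂ D (t ^ 2) := by
          rw [← map_mul, ← map_neg]
          congr 1
          linear_combination (t : ℂ) ^ 2 * Complex.I_mul_I
        rw [star_add, ha.star_eq, ← algebraMap_star_comm]
        have : star ((t : ℂ) * Complex.I) = - (t * Complex.I) := by simp
        rw [this, map_neg, add_mul, mul_add, mul_add, neg_mul, neg_mul, h5,
          (Algebra.commutes _ a).symm]
        abel
      rw [sq, ← CStarRing.norm_star_mul_self, h4]
      refine (norm_add_le _ _).trans (add_le_add ?_ ?_)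
      · exact (norm_mul_le a a).trans_eq (sq _).symm
      · rw [norm_algebraMap']
        simp
    have h4 : f (a + algebraMap ℂ D (t * Complex.I)) = f a + t * Complex.I := by
      rw [Algebra.algebraMap_eq_smul_one, map_add, map_smul, h1, smul_eq_mul, mul_one]
    rw [h4] at h2
    have h5 := Complex.abs_im_le_norm (f a + t * Complex.I)
    have h6 : |(f a + t * Complex.I).im| ^ 2 ≤ ‖a‖ ^ 2 + t ^ 2 :=
      (pow_le_pow_left₀ (abs_nonneg _) (h5.trans h2) 2).trans h3
    rw [sq_abs] at h6
    simp only [Complex.add_im, Complex.mul_im, Complex.ofReal_re, Complex.I_im, mul_one,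
      Complex.ofReal_im, Complex.I_re, mul_zero, add_zero] at h6
    nlinarith [sq_nonneg (f a).im]
  by_contra h0
  have h2 := key ((‖a‖ ^ 2 + 1) / (2 * (f a).im))
  rw [mul_div_cancel₀ _ (by simpa using h0)] at h2
  linarith

/-- A unital contractive functional is positive. -/
theorem re_nonneg_of_contractive (f : D →ₗ[ℂ] ℂ) (hf : ∀ d, ‖f d‖ ≤ ‖d‖) (h1 : f 1 = 1) (d : D) :
    0 ≤ (f (star d * d)).re := by
  have : Nontrivial D := ⟨⟨1, 0, fun h => by simp [h] at h1⟩⟩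
  let _ := CStarAlgebra.spectralOrder D
  have _ := CStarAlgebra.spectralOrderedRing D
  set a := star d * d with ha
  have ha0 : 0 ≤ a := star_mul_self_nonneg d
  -- Since `0 ≤ ‖a‖ - a ≤ ‖a‖`, contractivity gives `‖a‖ - Re f(a) ≤ ‖a‖`.
  have h2 : ‖algebraMap ℝ D ‖a‖ - a‖ ≤ ‖a‖ := by
    refine (CStarAlgebra.norm_le_norm_of_nonneg_of_le
      (sub_nonneg.2 (IsSelfAdjoint.le_algebraMap_norm_self ha0.isSelfAdjoint))
      (sub_le_self _ ha0)).trans ?_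
    rw [norm_algebraMap', norm_norm]
  have h3 := (hf _).trans h2
  have h4 : f (algebraMap ℝ D ‖a‖ - a) = ‖a‖ - f a := by
    rw [IsScalarTower.algebraMap_apply ℝ ℂ D, Algebra.algebraMap_eq_smul_one, map_sub, map_smul,
      h1, smul_eq_mul, mul_one]
    rfl
  rw [h4] at h3
  have h5 := (Complex.re_le_norm _).trans h3
  simp only [Complex.sub_re, Complex.ofReal_re] at h5
  linarith

end Functionals

/-- A complete contraction between C*-algebras. -/
def IsCC {A B : Type*} [CStarAlgebra A] [CStarAlgebra B] (φ : A →ₗ[ℂ] B) : Prop :=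
  ∀ (n : ℕ) (M : Matrix (Fin n) (Fin n) A), matrixNorm (M.map φ) ≤ matrixNorm M

theorem IsCC.norm_apply_le {A B : Type*} [CStarAlgebra A] [CStarAlgebra B] {φ : A →ₗ[ℂ] B}
    (hφ : IsCC φ) (a : A) : ‖φ a‖ ≤ ‖a‖ := by
  rw [← matrixNorm_fin_one, ← matrixNorm_fin_one a]
  exact hφ 1 _

/-- A unital complete contraction between C*-algebras. -/
structure IsUCC {A B : Type*} [CStarAlgebra A] [CStarAlgebra B] (φ : A →ₗ[ℂ] B) : Prop where
  map_one : φ 1 = 1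
  contractive : IsCC φ

/-! ### Unital complete contractions: positivity and the Schwarz inequality -/

namespace IsUCC

section Comp

variable {A B C : Type*} [CStarAlgebra A] [CStarAlgebra B] [CStarAlgebra C]

theorem comp {ψ : B →ₗ[ℂ] C} {φ : A →ₗ[ℂ] B} (hψ : IsUCC ψ) (hφ : IsUCC φ) : IsUCC (ψ ∘ₗ φ) where
  map_one := by simp [hφ.map_one, hψ.map_one]
  contractive n M := (hψ.contractive n (M.map φ)).trans (hφ.contractive n M)

theorem of_starAlgHom (π : A →⋆ₐ[ℂ] B) : IsUCC (π.toAlgHom.toLinearMap : A →ₗ[ℂ] B) where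
  map_one := _root_.map_one π
  contractive _ M := matrixNorm_map_le (π : A →⋆ₙₐ[ℂ] B) M

theorem norm_apply_le {φ : A →ₗ[ℂ] B} (hφ : IsUCC φ) (a : A) : ‖φ a‖ ≤ ‖a‖ :=
  hφ.contractive.norm_apply_le a

end Comp

variable {A : Type*} [CStarAlgebra A]
variable {H : Type*} [NormedAddCommGroup H] [InnerProductSpace ℂ H] [CompleteSpace H]
variable {φ : A →ₗ[ℂ] H →L[ℂ] H}

theorem norm_sum_inner_le (hφ : IsUCC φ) {n : ℕ} (M : Matrix (Fin n) (Fin n) A)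
    (ξ η : PiLp 2 (fun _ : Fin n => H)) :
    ‖∑ i, ∑ j, inner ℂ (η i) (φ (M i j) (ξ j))‖ ≤ matrixNorm M * ‖ξ‖ * ‖η‖ :=
  (OperatorSpace.norm_sum_inner_le (M.map φ) ξ η).trans (by gcongr; exact hφ.contractive n M)

/-- This is complete positivity. For `ξ ≠ 0`, `M ↦ ∑ ⟨ξᵢ, φ(Mᵢⱼ) ξⱼ⟩ / ‖ξ‖²` is a unital contractive
functional on `M_n(A)`, hence nonnegative on `c* c`. -/
theorem sum_inner_re_nonneg (hφ : IsUCC φ) {n : ℕ} (c : Matrix (Fin n) (Fin n) A)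
    (ξ : PiLp 2 (fun _ : Fin n => H)) :
    0 ≤ (∑ i, ∑ j, inner ℂ (ξ i) (φ (∑ k, star (c k i) * c k j) (ξ j))).re := by
  let _ := CStarAlgebra.spectralOrder A
  have _ := CStarAlgebra.spectralOrderedRing A
  by_cases h0 : ξ = 0
  · simp [h0]
  have h0' : 0 < ‖ξ‖ := norm_pos_iff.2 h0
  let g : CStarMatrix (Fin n) (Fin n) A →ₗ[ℂ] ℂ :=
    { toFun := fun M => ∑ i, ∑ j, inner ℂ (ξ i) (φ (M i j) (ξ j))
      map_add' := fun M N => by simp [Finset.sum_add_distrib]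
      map_smul' := fun z M => by simp [Finset.mul_sum] }
  have hg : ∀ M, ‖g M‖ ≤ ‖M‖ * ‖ξ‖ * ‖ξ‖ := fun M => hφ.norm_sum_inner_le M ξ ξ
  have hg1 : g 1 = ((‖ξ‖ ^ 2 : ℝ) : ℂ) := by
    have : g 1 = ∑ i, ∑ j, inner ℂ (ξ i) (φ ((1 : CStarMatrix (Fin n) (Fin n) A) i j) (ξ j)) := rfl
    rw [this]
    simp only [CStarMatrix.one_apply, apply_ite φ, hφ.map_one, map_zero]
    have h : inner ℂ ξ ξ = ((‖ξ‖ ^ 2 : ℝ) : ℂ) := by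
      rw [inner_self_eq_norm_sq_to_K]
      simp
    rw [← h, PiLp.inner_apply]
    refine Finset.sum_congr rfl fun i _ => ?_
    rw [Finset.sum_eq_single i] <;> simp +contextual [eq_comm]
  have h2 := re_nonneg_of_contractive (((‖ξ‖ ^ 2)⁻¹ : ℝ) • g) (fun M => ?_) ?_
    (CStarMatrix.ofMatrix c)
  · rw [LinearMap.smul_apply, Complex.smul_re, smul_eq_mul] at h2
    exact nonneg_of_mul_nonneg_right h2 (by positivity)
  · rw [LinearMap.smul_apply, norm_smul, Real.norm_of_nonneg (by positivity),
      inv_mul_le_iff₀ (by positivity)]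
    exact (hg M).trans_eq (by ring)
  · rw [LinearMap.smul_apply, hg1, Complex.real_smul, ← Complex.ofReal_mul,
      inv_mul_cancel₀ (by positivity), Complex.ofReal_one]

theorem isSelfAdjoint_map (hφ : IsUCC φ) {a : A} (ha : IsSelfAdjoint a) :
    IsSelfAdjoint (φ a) := by
  rw [ContinuousLinearMap.isSelfAdjoint_iff_isSymmetric,
    LinearMap.isSymmetric_iff_inner_map_self_real]
  intro ξ
  refine Complex.conj_eq_iff_im.2 ?_
  rw [← inner_conj_symm, Complex.conj_im, neg_eq_zero]
  by_cases h0 : ξ = 0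
  · simp [h0]
  have h0' : 0 < ‖ξ‖ := norm_pos_iff.2 h0
  let g : A →ₗ[ℂ] ℂ :=
    { toFun := fun a => inner ℂ ξ (φ a ξ)
      map_add' := fun M N => by simp
      map_smul' := fun z M => by simp }
  have hg : ∀ M, ‖g M‖ ≤ ‖M‖ * ‖ξ‖ ^ 2 := fun M => calc
    ‖g M‖ ≤ ‖ξ‖ * (‖φ M‖ * ‖ξ‖) :=
      (norm_inner_le_norm _ _).trans (by gcongr; exact (φ M).le_opNorm ξ)
    _ ≤ ‖ξ‖ * (‖M‖ * ‖ξ‖) := by gcongr; exact hφ.norm_apply_le M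
    _ = ‖M‖ * ‖ξ‖ ^ 2 := by ring
  have hg1 : g 1 = ((‖ξ‖ ^ 2 : ℝ) : ℂ) := by
    simp [g, hφ.map_one, inner_self_eq_norm_sq_to_K]
  have h2 := im_eq_zero_of_contractive (((‖ξ‖ ^ 2)⁻¹ : ℝ) • g) (fun M => ?_) ?_ ha
  · rw [LinearMap.smul_apply, Complex.smul_im, smul_eq_mul] at h2
    exact (mul_eq_zero.1 h2).resolve_left (by positivity)
  · rw [LinearMap.smul_apply, norm_smul, Real.norm_of_nonneg (by positivity),
      inv_mul_le_iff₀ (by positivity)]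
    exact (hg M).trans_eq (by ring)
  · rw [LinearMap.smul_apply, hg1, Complex.real_smul, ← Complex.ofReal_mul,
      inv_mul_cancel₀ (by positivity), Complex.ofReal_one]

theorem map_star (hφ : IsUCC φ) (a : A) : φ (star a) = star (φ a) := by
  have h1 := hφ.isSelfAdjoint_map (realPart a).2
  have h2 := hφ.isSelfAdjoint_map (imaginaryPart a).2
  rw [← realPart_add_I_smul_imaginaryPart a]
  simp only [star_add, star_smul, map_add, map_smul, h1.star_eq, h2.star_eq,
    (realPart a).2.star_eq, (imaginaryPart a).2.star_eq]

/-- The Schwarz inequality. -/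
theorem norm_sq_le (hφ : IsUCC φ) (a : A) (ξ : H) :
    ‖φ a ξ‖ ^ 2 ≤ (inner ℂ ξ (φ (star a * a) ξ)).re := by
  -- For this `c`, `c* c` has rows `(1, a)` and `(a*, a* a)`. Pairing with `(-φ(a)ξ, ξ)` completes
  -- the square.
  have h := hφ.sum_inner_re_nonneg (n := 2) !![1, a; 0, 0] (WithLp.toLp 2 ![-φ a ξ, ξ])
  have h3 : inner ℂ ξ (star (φ a) (φ a ξ)) = ((‖φ a ξ‖ ^ 2 : ℝ) : ℂ) := by
    rw [ContinuousLinearMap.star_eq_adjoint, ContinuousLinearMap.adjoint_inner_right,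
      inner_self_eq_norm_sq_to_K]
    simp
  have h4 : inner ℂ (φ a ξ) (φ a ξ) = ((‖φ a ξ‖ ^ 2 : ℝ) : ℂ) := by
    rw [inner_self_eq_norm_sq_to_K]
    simp
  simp only [Fin.sum_univ_two, Matrix.of_apply, Matrix.cons_val_zero, Matrix.cons_val_one,
    Matrix.cons_val', Matrix.cons_val_fin_one, star_one, mul_one, one_mul, mul_zero, add_zero, hφ.map_one, hφ.map_star, map_neg, inner_neg_left, inner_neg_right,
    one_apply_eq_self, h3, h4, neg_neg, Complex.add_re, Complex.neg_re,
    Complex.ofReal_re] at h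
  linarith

end IsUCC

/-! ### Kernels, ranges and lifts for *-homomorphisms -/

section Homs

variable {D A B : Type*} [CStarAlgebra D] [CStarAlgebra A] [CStarAlgebra B]

theorem exists_factor (ρ : D →⋆ₐ[ℂ] A) (hρ : Function.Surjective ρ) (σ : D →⋆ₐ[ℂ] B)
    (h : ∀ d, ρ d = 0 → σ d = 0) : ∃ τ : A →⋆ₐ[ℂ] B, ∀ d, τ (ρ d) = σ d := by
  have key : ∀ d, σ (Function.surjInv hρ (ρ d)) = σ d := fun d => by
    rw [← sub_eq_zero, ← map_sub]
    exact h _ (by rw [map_sub, Function.surjInv_eq hρ, sub_self])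
  refine ⟨{ toFun := fun a => σ (Function.surjInv hρ a)
            map_one' := ?_
            map_mul' := fun a b => ?_
            map_zero' := ?_
            map_add' := fun a b => ?_
            commutes' := fun z => ?_
            map_star' := fun a => ?_ }, key⟩
  · simpa using key 1
  · obtain ⟨a, rfl⟩ := hρ a
    obtain ⟨b, rfl⟩ := hρ b
    rw [← map_mul, key, key, key, map_mul]
  · simpa using key 0
  · obtain ⟨a, rfl⟩ := hρ a
    obtain ⟨b, rfl⟩ := hρ b
    rw [← map_add, key, key, key, map_add]
  · have := key (algebraMap ℂ D z)
    rwa [AlgHomClass.commutes ρ, AlgHomClass.commutes σ] at this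
  · obtain ⟨a, rfl⟩ := hρ a
    rw [← map_star, key, key, map_star]

theorem continuous_starAlgHom (ρ : D →⋆ₐ[ℂ] A) : Continuous ρ :=
  AddMonoidHomClass.continuous_of_bound ρ 1 fun a => by
    simpa using NonUnitalStarAlgHom.norm_apply_le ρ a

instance isClosed_ker (ρ : D →⋆ₐ[ℂ] A) : IsClosed (RingHom.ker ρ : Set D) := by
  have : (RingHom.ker ρ : Set D) = ρ ⁻¹' {0} := by
    ext
    simp [RingHom.mem_ker]
  rw [this]
  exact isClosed_singleton.preimage (continuous_starAlgHom ρ)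

/-- The induced map on the quotient is injective, and injective *-homomorphisms of C*-algebras are
isometric. -/
theorem exists_isometry_quotient_ker (ρ : D →⋆ₐ[ℂ] A) :
    ∃ τ : D ⧸ RingHom.ker ρ →⋆ₐ[ℂ] A, (∀ d, τ (CStarQuotient.mk (RingHom.ker ρ) d) = ρ d) ∧
      ∀ x, ‖τ x‖ = ‖x‖ := by
  obtain ⟨τ, hτ⟩ := exists_factor (CStarQuotient.mk (RingHom.ker ρ))
    Ideal.Quotient.mk_surjective ρ
    fun d hd => Ideal.Quotient.eq_zero_iff_mem.1 hd
  refine ⟨τ, hτ, fun x => NonUnitalStarAlgHom.norm_map τ ?_ x⟩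
  refine (injective_iff_map_eq_zero τ).2 fun x hx => ?_
  obtain ⟨d, rfl⟩ := Ideal.Quotient.mk_surjective x
  exact Ideal.Quotient.eq_zero_iff_mem.2 ((hτ d).symm.trans hx)

/-- Elements of the range of a *-homomorphism lift with almost no increase of the norm. -/
theorem exists_lift_norm_lt (ρ : D →⋆ₐ[ℂ] A) (d : D) {ε : ℝ} (hε : 0 < ε) :
    ∃ d', ρ d' = ρ d ∧ ‖d'‖ < ‖ρ d‖ + ε := by
  obtain ⟨τ, hτ, hn⟩ := exists_isometry_quotient_ker ρ
  obtain ⟨d', h1, h2⟩ := CStarQuotient.exists_lift (RingHom.ker ρ)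
    (CStarQuotient.mk (RingHom.ker ρ) d) hε
  refine ⟨d', ?_, ?_⟩
  · rw [← hτ, ← hτ]
    exact congrArg τ h1
  · rwa [← hn, hτ] at h2

theorem isClosed_range (ρ : D →⋆ₐ[ℂ] A) : IsClosed (Set.range ρ) := by
  obtain ⟨τ, hτ, hn⟩ := exists_isometry_quotient_ker ρ
  have h : Set.range ρ = Set.range τ := by
    ext a
    constructor
    · rintro ⟨d, rfl⟩
      exact ⟨_, hτ d⟩
    · rintro ⟨x, rfl⟩
      obtain ⟨d, rfl⟩ := Ideal.Quotient.mk_surjective x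
      exact ⟨d, (hτ d).symm⟩
  rw [h]
  exact (AddMonoidHomClass.isometry_of_norm τ hn).isClosedEmbedding.isClosed_range

theorem surjective_of_generates (ρ : D →⋆ₐ[ℂ] A) {S : Set A} (hS : Generates S)
    (h : S ⊆ Set.range ρ) : Function.Surjective ρ := by
  have h1 : (StarAlgebra.adjoin ℂ S).topologicalClosure ≤ ρ.range :=
    StarSubalgebra.topologicalClosure_minimal
      (StarAlgebra.adjoin_le h) (isClosed_range ρ)
  rw [hS] at h1
  intro a
  exact h1 (StarSubalgebra.mem_top (R := ℂ) (x := a))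

theorem eq_of_generates {S : Set D} (hS : Generates S) {ρ σ : D →⋆ₐ[ℂ] A}
    (h : ∀ s ∈ S, ρ s = σ s) : ρ = σ := by
  have h1 : (StarAlgebra.adjoin ℂ S).topologicalClosure ≤ StarAlgHom.equalizer ρ σ :=
    StarSubalgebra.topologicalClosure_minimal
      (StarAlgebra.adjoin_le h) (isClosed_eq (continuous_starAlgHom ρ) (continuous_starAlgHom σ))
  rw [hS] at h1
  ext a
  exact h1 (StarSubalgebra.mem_top (R := ℂ) (x := a))

theorem generates_image (ρ : D →⋆ₐ[ℂ] A) (hρ : Function.Surjective ρ) {S : Set D}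
    (hS : Generates S) : Generates (ρ '' S) := by
  rw [Generates, eq_top_iff, ← StarAlgHom.map_adjoin]
  rintro a -
  obtain ⟨d, rfl⟩ := hρ a
  have hd : d ∈ (StarAlgebra.adjoin ℂ S).topologicalClosure := hS ▸ StarSubalgebra.mem_top
  exact image_closure_subset_closure_image (continuous_starAlgHom ρ) ⟨d, hd, rfl⟩

/-- The entrywise map `M_n(D) → M_n(A)` is itself a unital *-homomorphism, so the scalar lifting
result applies to it. -/
theorem exists_lift_matrixNorm_lt (ρ : D →⋆ₐ[ℂ] A) {n : ℕ} (M : Matrix (Fin n) (Fin n) D) {ε : ℝ}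
    (hε : 0 < ε) : ∃ N : Matrix (Fin n) (Fin n) D, N.map ρ = M.map ρ ∧
      matrixNorm N < matrixNorm (M.map ρ) + ε := by
  let _ := CStarAlgebra.spectralOrder D
  have _ := CStarAlgebra.spectralOrderedRing D
  let _ := CStarAlgebra.spectralOrder A
  have _ := CStarAlgebra.spectralOrderedRing A
  let ρn : CStarMatrix (Fin n) (Fin n) D →⋆ₐ[ℂ] CStarMatrix (Fin n) (Fin n) A :=
    { CStarMatrix.mapₙₐ (n := Fin n) (ρ : D →⋆ₙₐ[ℂ] A) with
      map_one' := by
        ext i j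
        simp [CStarMatrix.one_apply, apply_ite ρ]
      commutes' := fun z => by
        ext i j
        simp [CStarMatrix.algebraMap_apply, apply_ite ρ, AlgHomClass.commutes ρ] }
  exact exists_lift_norm_lt ρn (CStarMatrix.ofMatrix M) hε

end Homs

/-! ### Direct sums of representations and separating states -/

section Representation

variable {ι : Type*} {E : ι → Type*} [∀ i, NormedAddCommGroup (E i)]
  [∀ i, InnerProductSpace ℂ (E i)]

/-- The diagonal operator on a Hilbert sum given by a uniformly bounded family of operators. -/
def diagonalOperator (T : ∀ i, E i →L[ℂ] E i) (r : ℝ) (hr : ∀ i, ‖T i‖ ≤ r) :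
    lp E 2 →L[ℂ] lp E 2 :=
  have h : ∀ (v : lp E 2) i, ‖T i (v i)‖ ^ (2 : ENNReal).toReal
      ≤ r ^ (2 : ENNReal).toReal * ‖v i‖ ^ (2 : ENNReal).toReal := fun v i => by
    rw [← Real.mul_rpow ((norm_nonneg _).trans (hr i)) (norm_nonneg _)]
    exact Real.rpow_le_rpow (norm_nonneg _) ((T i).le_of_opNorm_le (hr i) _) (by norm_num)
  have hs : ∀ v : lp E 2, Summable fun i => ‖v i‖ ^ (2 : ENNReal).toReal := fun v =>
    (lp.memℓp v).summable (by norm_num)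
  LinearMap.mkContinuous
    { toFun := fun v => ⟨fun i => T i (v i), memℓp_gen <| Summable.of_nonneg_of_le
        (fun i => by positivity) (h v) ((hs v).mul_left _)⟩
      map_add' := fun v w => by
        ext i
        exact map_add (T i) _ _
      map_smul' := fun z v => by
        ext i
        -- The absolute value matters only for an empty index type, where `r` may be negative.
        simp } |r| fun v => by
      refine lp.norm_le_of_tsum_le (by norm_num) (by positivity) ?_
      rw [Real.mul_rpow (abs_nonneg r) (norm_nonneg v), lp.norm_rpow_eq_tsum (by norm_num),
        ← tsum_mul_left]
      refine Summable.tsum_le_tsum (fun i => (h v i).trans ?_)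
        (Summable.of_nonneg_of_le (fun i => by positivity) (h v) ((hs v).mul_left _))
        ((hs v).mul_left _)
      rw [abs_of_nonneg ((norm_nonneg _).trans (hr i))]

theorem diagonalOperator_apply (T : ∀ i, E i →L[ℂ] E i) (r : ℝ) (hr : ∀ i, ‖T i‖ ≤ r)
    (v : lp E 2) (i : ι) : diagonalOperator T r hr v i = T i (v i) := rfl

variable [∀ i, CompleteSpace (E i)] {A : Type*} [CStarAlgebra A]

/-- The direct sum of a family of representations. -/
def sumRepresentation (π : ∀ i, A →⋆ₐ[ℂ] (E i →L[ℂ] E i)) : A →⋆ₐ[ℂ] (lp E 2 →L[ℂ] lp E 2) where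
  toFun a := diagonalOperator (fun i => π i a) ‖a‖ fun i => NonUnitalStarAlgHom.norm_apply_le _ a
  map_one' := by
    ext v i
    simp [diagonalOperator_apply]
  map_mul' a b := by
    ext v i
    simp [diagonalOperator_apply]
  map_zero' := by
    ext v i
    simp [diagonalOperator_apply]
  map_add' a b := by
    ext v i
    simp [diagonalOperator_apply]
  commutes' z := by
    ext v i
    simp [diagonalOperator_apply, Algebra.algebraMap_eq_smul_one]
  map_star' a := by
    rw [ContinuousLinearMap.star_eq_adjoint, ContinuousLinearMap.eq_adjoint_iff]
    intro v w
    simp_rw [lp.inner_eq_tsum, diagonalOperator_apply, map_star,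
      ContinuousLinearMap.star_eq_adjoint, ContinuousLinearMap.adjoint_inner_left]

/-- States separate the positive elements of a C*-algebra from `0`. -/
theorem exists_state {a : A} (ha : a ≠ 0) : ∃ f : A →ₗ[ℂ] ℂ, (∀ d, ‖f d‖ ≤ ‖d‖) ∧ f 1 = 1 ∧
    f (star a * a) ≠ 0 := by
  have : Nontrivial A := ⟨⟨a, 0, ha⟩⟩
  let _ := CStarAlgebra.spectralOrder A
  have _ := CStarAlgebra.spectralOrderedRing A
  set h := star a * a with hh
  have h0 : 0 ≤ h := star_mul_self_nonneg a
  have hn : 0 < ‖h‖ := by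
    rw [hh, CStarRing.norm_star_mul_self]
    have := norm_pos_iff.2 ha
    positivity
  -- The value `2‖h‖` is attained because `‖h‖` lies in the spectrum of `h ≥ 0`. For a norming
  -- functional `f`, `‖h‖ f(1) + f(h) = 2‖h‖` with `|f(1)| ≤ 1` and `|f(h)| ≤ ‖h‖` forces `f(1) = 1`
  -- and `f(h) ≠ 0`.
  have h2 : ‖algebraMap ℝ A ‖h‖ + h‖ = ‖h‖ + ‖h‖ := by
    refine le_antisymm ((norm_add_le _ _).trans (by rw [norm_algebraMap', norm_norm])) ?_
    have h3 : ‖h‖ ∈ spectrum ℝ h := CStarAlgebra.norm_mem_spectrum_of_nonneg h0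
    have h4 := (spectrum.add_mem_add_iff (s := ‖h‖)).2 h3
    have := spectrum.norm_le_norm_of_mem h4
    rwa [Real.norm_of_nonneg (by positivity)] at this
  obtain ⟨f, hf1, hf2⟩ := exists_dual_vector ℂ (algebraMap ℝ A ‖h‖ + h)
    (by rw [h2]; exact (add_pos hn hn).ne')
  have hfn : ∀ d, ‖f d‖ ≤ ‖d‖ := fun d => (f.le_opNorm d).trans_eq (by rw [hf1, one_mul])
  have h3 : f (algebraMap ℝ A ‖h‖ + h) = ‖h‖ * f 1 + f h := by
    rw [IsScalarTower.algebraMap_apply ℝ ℂ A, Algebra.algebraMap_eq_smul_one, map_add, map_smul]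
    rfl
  rw [h3, h2] at hf2
  have h4 := congrArg Complex.re hf2
  simp only [Complex.add_re, Complex.mul_re, Complex.ofReal_re, Complex.ofReal_im, zero_mul,
    sub_zero, Complex.coe_algebraMap] at h4
  have h5 : ‖f 1‖ ≤ 1 := (hfn 1).trans_eq norm_one
  have h6 := (Complex.re_le_norm _).trans (hfn h)
  have h7 : (f 1).re = 1 := by
    refine le_antisymm ((Complex.re_le_norm _).trans h5) ?_
    by_contra! h8
    nlinarith
  have h8 : (f 1).im = 0 := by
    have := Complex.sq_norm (f 1)
    rw [Complex.normSq_apply, h7] at this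
    nlinarith [norm_nonneg (f 1)]
  refine ⟨f, hfn, Complex.ext h7 h8, fun h9 => ?_⟩
  change f h = 0 at h9
  rw [h9, h7, Complex.zero_re] at h4
  linarith

end Representation

/-! ### The GNS construction and faithful representations -/

section GNS

open scoped ComplexOrder

variable {A : Type u} [CStarAlgebra A]

/-- The GNS representation of a unital contractive functional. -/
theorem exists_gns (f : A →ₗ[ℂ] ℂ) (hf : ∀ d, ‖f d‖ ≤ ‖d‖) (h1 : f 1 = 1) :
    ∃ (H : Type u) (_ : NormedAddCommGroup H) (_ : InnerProductSpace ℂ H) (_ : CompleteSpace H)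
      (π : A →⋆ₐ[ℂ] (H →L[ℂ] H)) (Ω : H), ∀ a, inner ℂ Ω (π a Ω) = f a := by
  let _ := CStarAlgebra.spectralOrder A
  have _ := CStarAlgebra.spectralOrderedRing A
  let g : A →ₚ[ℂ] ℂ := PositiveLinearMap.mk₀ f fun x hx => by
    obtain ⟨y, rfl⟩ := CStarAlgebra.nonneg_iff_eq_star_mul_self.1 hx
    exact Complex.le_def.2 ⟨re_nonneg_of_contractive f hf h1 y,
      (im_eq_zero_of_contractive f hf h1 (.star_mul_self y)).symm⟩
  refine ⟨g.GNS, inferInstance, inferInstance, inferInstance, g.gnsStarAlgHom,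
    (g.toPreGNS 1 : g.GNS), fun a => ?_⟩
  change inner ℂ (g.toPreGNS 1 : g.GNS) (g.gnsNonUnitalStarAlgHom a (g.toPreGNS 1 : g.GNS)) = f a
  rw [PositiveLinearMap.gnsNonUnitalStarAlgHom_apply_coe, UniformSpace.Completion.inner_coe, PositiveLinearMap.preGNS_inner_def]
  simp only [PositiveLinearMap.ofPreGNS_toPreGNS, star_one, one_mul,
    PositiveLinearMap.leftMulMapPreGNS_apply, mul_one]
  rfl

/-- Every C*-algebra has a faithful representation. -/
theorem exists_faithful_representation (A : Type u) [CStarAlgebra A] :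
    ∃ (H : Type u) (_ : NormedAddCommGroup H) (_ : InnerProductSpace ℂ H) (_ : CompleteSpace H)
      (π : A →⋆ₐ[ℂ] (H →L[ℂ] H)), Function.Injective π := by
  classical
  -- The sum runs over all states: an element `a` killed by it has `f(a* a) = ‖π_f(a) Ω_f‖² = 0` for
  -- every state `f`.
  choose H i1 i2 i3 π Ω hπ using fun f : {f : A →ₗ[ℂ] ℂ // (∀ d, ‖f d‖ ≤ ‖d‖) ∧ f 1 = 1} =>
    exists_gns f.1 f.2.1 f.2.2
  refine ⟨lp H 2, inferInstance, inferInstance, inferInstance, sumRepresentation π, ?_⟩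
  refine (injective_iff_map_eq_zero _).2 fun a ha => ?_
  by_contra h0
  obtain ⟨f, hf, h1, hfa⟩ := exists_state h0
  have h2 := congrArg (fun T => T (lp.single 2 ⟨f, hf, h1⟩ (Ω ⟨f, hf, h1⟩)) ⟨f, hf, h1⟩) ha
  simp only [sumRepresentation] at h2
  have h3 : π ⟨f, hf, h1⟩ a (Ω ⟨f, hf, h1⟩) = 0 := by
    have h4 : (lp.single 2 ⟨f, hf, h1⟩ (Ω ⟨f, hf, h1⟩) : lp H 2) ⟨f, hf, h1⟩ = Ω ⟨f, hf, h1⟩ :=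
      lp.single_apply_self ..
    rw [← h4]
    exact h2
  apply hfa
  rw [← hπ ⟨f, hf, h1⟩, map_mul]
  simp [h3]

end GNS

section

open Filter Topology

/-! ### Weak operator limits of complete contractions -/

section UltrafilterLimit

variable {A : Type*} [CStarAlgebra A]
variable {H : Type*} [NormedAddCommGroup H] [InnerProductSpace ℂ H] [CompleteSpace H]

/-- Complete contractions into `B(H)` have limits, in the weak operator topology, along
ultrafilters. -/
theorem exists_ultrafilter_limit {K : Type*} (u : Ultrafilter K) (Φ : K → A →ₗ[ℂ] H →L[ℂ] H)
    (hΦ : ∀ k, IsCC (Φ k)) : ∃ Ψ : A →ₗ[ℂ] H →L[ℂ] H, IsCC Ψ ∧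
      ∀ a ξ η, Tendsto (fun k => inner ℂ (Φ k a ξ) η) u (𝓝 (inner ℂ (Ψ a ξ) η)) := by
  have hb : ∀ a ξ η k, ‖inner ℂ (Φ k a ξ) η‖ ≤ ‖a‖ * ‖ξ‖ * ‖η‖ := fun a ξ η k =>
    (norm_inner_le_norm _ _).trans <| mul_le_mul_of_nonneg_right
      ((Φ k a).le_of_opNorm_le ((hΦ k).norm_apply_le a) ξ) (norm_nonneg η)
  have hex : ∀ a ξ η, ∃ z : ℂ, Tendsto (fun k => inner ℂ (Φ k a ξ) η) u (𝓝 z) := fun a ξ η => by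
    obtain ⟨z, -, hz⟩ := (isCompact_closedBall (0 : ℂ) (‖a‖ * ‖ξ‖ * ‖η‖)).ultrafilter_le_nhds
      (u.map fun k => inner ℂ (Φ k a ξ) η)
      (le_principal_iff.2 <| mem_map.2 <| Eventually.of_forall fun k => by simpa using hb a ξ η k)
    exact ⟨z, hz⟩
  choose L hL using hex
  have hLb : ∀ a ξ η, ‖L a ξ η‖ ≤ ‖a‖ * ‖ξ‖ * ‖η‖ := fun a ξ η =>
    le_of_tendsto (hL a ξ η).norm (Eventually.of_forall (hb a ξ η))
  -- The limits `L a` form a bounded sesquilinear form, which is represented by an operator.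
  let S : A → H →L⋆[ℂ] H →L[ℂ] ℂ := fun a =>
    LinearMap.mkContinuous₂ (LinearMap.mk₂'ₛₗ (starRingEnd ℂ) (RingHom.id ℂ) (L a)
      (fun ξ ξ' η => tendsto_nhds_unique (hL _ _ _) <| by
        simpa [inner_add_left] using (hL a ξ η).add (hL a ξ' η))
      (fun z ξ η => tendsto_nhds_unique (hL _ _ _) <| by
        simpa [inner_smul_left, mul_comm] using (hL a ξ η).const_mul (starRingEnd ℂ z))
      (fun ξ η η' => tendsto_nhds_unique (hL _ _ _) <| by
        simpa [inner_add_right] using (hL a ξ η).add (hL a ξ η'))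
      (fun z ξ η => tendsto_nhds_unique (hL _ _ _) <| by
        simpa [inner_smul_right] using (hL a ξ η).const_mul z)) ‖a‖ (hLb a)
  have hT : ∀ a ξ η, inner ℂ (InnerProductSpace.continuousLinearMapOfBilin (S a) ξ) η = L a ξ η :=
    fun a ξ η => InnerProductSpace.continuousLinearMapOfBilin_apply (S a) ξ η
  let Ψ : A →ₗ[ℂ] H →L[ℂ] H :=
    { toFun := fun a => InnerProductSpace.continuousLinearMapOfBilin (S a)
      map_add' := fun a b => by
        ext ξ
        refine ext_inner_right ℂ fun η => ?_
        rw [_root_.add_apply, inner_add_left, hT, hT, hT]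
        exact tendsto_nhds_unique (hL _ _ _) <| by
          simpa [inner_add_left] using (hL a ξ η).add (hL b ξ η)
      map_smul' := fun z a => by
        ext ξ
        refine ext_inner_right ℂ fun η => ?_
        rw [RingHom.id_apply, _root_.smul_apply, inner_smul_left, hT, hT]
        exact tendsto_nhds_unique (hL _ _ _) <| by
          simpa [inner_smul_left, mul_comm] using (hL a ξ η).const_mul (starRingEnd ℂ z) }
  have hΨ : ∀ a ξ η, Tendsto (fun k => inner ℂ (Φ k a ξ) η) u (𝓝 (inner ℂ (Ψ a ξ) η)) :=
    fun a ξ η => (hT a ξ η).symm ▸ hL a ξ η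
  have hΨ' : ∀ a ξ η, Tendsto (fun k => inner ℂ η (Φ k a ξ)) u (𝓝 (inner ℂ η (Ψ a ξ))) :=
    fun a ξ η => by
      have := (Complex.continuous_conj.tendsto _).comp (hΨ a ξ η)
      simpa [Function.comp_def, inner_conj_symm] using this
  refine ⟨Ψ, fun n M => matrixNorm_le_of_forall_inner _ (matrixNorm_nonneg M) fun ξ η => ?_, hΨ⟩
  have hlim : Tendsto (fun k => ∑ i, ∑ j, inner ℂ (η i) (Φ k (M i j) (ξ j))) u
      (𝓝 (∑ i, ∑ j, inner ℂ (η i) (Ψ (M i j) (ξ j)))) :=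
    tendsto_finsetSum _ fun i _ => tendsto_finsetSum _ fun j _ => hΨ' _ _ _
  refine le_of_tendsto hlim.norm (Eventually.of_forall fun k => ?_)
  refine (norm_sum_inner_le (M.map (Φ k)) ξ η).trans ?_
  gcongr
  exact hΦ k n M

end UltrafilterLimit

/-! ### Arveson's extension theorem -/

section Extension

variable {A : Type u} [CStarAlgebra A]
variable {H : Type*} [NormedAddCommGroup H] [InnerProductSpace ℂ H] [CompleteSpace H]
variable {K : Type*} [NormedAddCommGroup K] [InnerProductSpace ℂ K] [CompleteSpace K]

/-- The compression of a representation by a contraction. -/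
def compression (σ : A →⋆ₙₐ[ℂ] (K →L[ℂ] K)) (V : H →L[ℂ] K) : A →ₗ[ℂ] H →L[ℂ] H where
  toFun a := ContinuousLinearMap.adjoint V ∘L σ a ∘L V
  map_add' a b := by
    ext
    simp
  map_smul' z a := by
    ext
    simp

theorem inner_compression (σ : A →⋆ₙₐ[ℂ] (K →L[ℂ] K)) (V : H →L[ℂ] K) (a : A) (ξ η : H) :
    inner ℂ η (compression σ V a ξ) = inner ℂ (V η) (σ a (V ξ)) :=
  ContinuousLinearMap.adjoint_inner_right V η _

theorem isCC_compression (σ : A →⋆ₙₐ[ℂ] (K →L[ℂ] K)) (V : H →L[ℂ] K) (hV : ∀ ξ, ‖V ξ‖ ≤ ‖ξ‖) :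
    IsCC (compression σ V) := by
  intro n M
  refine matrixNorm_le_of_forall_inner _ (matrixNorm_nonneg M) fun ξ η => ?_
  have hn : ∀ ζ : PiLp 2 (fun _ : Fin n => H),
      ‖(WithLp.toLp 2 fun i => V (ζ i) : PiLp 2 (fun _ : Fin n => K))‖ ≤ ‖ζ‖ := fun ζ => by
    rw [PiLp.norm_eq_of_L2, PiLp.norm_eq_of_L2]
    refine Real.sqrt_le_sqrt (Finset.sum_le_sum fun i _ => ?_)
    exact pow_le_pow_left₀ (norm_nonneg _) (hV _) 2
  simp only [Matrix.map_apply, inner_compression]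
  refine (norm_sum_inner_le (M.map σ) (WithLp.toLp 2 fun i => V (ξ i))
    (WithLp.toLp 2 fun i => V (η i))).trans ?_
  gcongr
  · exact mul_nonneg (matrixNorm_nonneg M) (norm_nonneg ξ)
  · exact matrixNorm_nonneg M
  · exact matrixNorm_map_le σ M
  · exact hn ξ
  · exact hn η

/-- A unital complete contraction of a subspace containing the unit. -/
structure IsUCCOn (X : Submodule ℂ A) {B : Type*} [CStarAlgebra B] (φ : X →ₗ[ℂ] B) : Prop where
  map_one : ∀ e : X, (e : A) = 1 → φ e = 1
  contractive : ∀ (n : ℕ) (M : Matrix (Fin n) (Fin n) X),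
    matrixNorm (M.map φ) ≤ matrixNorm (M.map ((↑) : X → A))

theorem IsUCIS.isUCCOn {X : Submodule ℂ A} {B : Type*} [CStarAlgebra B] {φ : X →ₗ[ℂ] B}
    (h : IsUCIS X φ) : IsUCCOn X φ :=
  ⟨h.map_one, fun n M => (h.isometric n M).le⟩

/-- A unital complete contraction, averaged over an orthonormal family, extends to a state on
matrices. -/
theorem exists_matrix_state {X : Submodule ℂ A} (hX : IsUnital X) {φ : X →ₗ[ℂ] H →L[ℂ] H}
    (hφ : IsUCCOn X φ) {n : ℕ} (hn : n ≠ 0) {e : Fin n → H} (he : Orthonormal ℂ e) :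
    letI := CStarAlgebra.spectralOrder A
    haveI := CStarAlgebra.spectralOrderedRing A
    ∃ f : CStarMatrix (Fin n) (Fin n) A →ₗ[ℂ] ℂ, (∀ d, ‖f d‖ ≤ ‖d‖) ∧ f 1 = 1 ∧
      ∀ (x : X) i j, n * f (CStarMatrix.ofMatrix (Matrix.single i j (x : A)))
        = inner ℂ (e i) (φ x (e j)) := by
  let _ := CStarAlgebra.spectralOrder A
  have _ := CStarAlgebra.spectralOrderedRing A
  let W : Submodule ℂ (CStarMatrix (Fin n) (Fin n) A) :=
    { carrier := {M | ∀ i j, M i j ∈ X}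
      add_mem' := fun hM hN i j => X.add_mem (hM i j) (hN i j)
      zero_mem' := fun i j => X.zero_mem
      smul_mem' := fun z M hM i j => X.smul_mem z (hM i j) }
  let g : W →ₗ[ℂ] ℂ :=
    { toFun := fun M => (n : ℂ)⁻¹ * ∑ i, ∑ j, inner ℂ (e i) (φ ⟨M.1 i j, M.2 i j⟩ (e j))
      map_add' := fun M N => by
        rw [← mul_add, ← Finset.sum_add_distrib]
        simp_rw [← Finset.sum_add_distrib, ← inner_add_right, ← _root_.add_apply, ← map_add]
        rfl
      map_smul' := fun z M => by
        rw [RingHom.id_apply, smul_eq_mul, mul_left_comm, Finset.mul_sum]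
        simp_rw [Finset.mul_sum, ← inner_smul_right, ← _root_.smul_apply, ← map_smul]
        rfl }
  have hn0 : (n : ℂ) ≠ 0 := Nat.cast_ne_zero.2 hn
  have hg : ∀ M, ‖g M‖ ≤ 1 * ‖M‖ := fun M => by
    let N : Matrix (Fin n) (Fin n) X := Matrix.of fun i j => ⟨M.1 i j, M.2 i j⟩
    have h1 := norm_sum_inner_le (N.map φ) (WithLp.toLp 2 e) (WithLp.toLp 2 e)
    -- An orthonormal family of length `n` has norm `√n` in `Hⁿ`, which explains the factor `n⁻¹` in
    -- `g`.
    have h2 : ‖(WithLp.toLp 2 e : PiLp 2 fun _ : Fin n => H)‖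
        * ‖(WithLp.toLp 2 e : PiLp 2 fun _ : Fin n => H)‖ = n := by
      rw [← sq, PiLp.norm_sq_eq_of_L2]
      simp [he.1]
    have h3 : matrixNorm (N.map φ) ≤ ‖M‖ := hφ.contractive n N
    rw [mul_assoc, h2] at h1
    change ‖(n : ℂ)⁻¹ * ∑ i, ∑ j, inner ℂ (e i) (N.map φ i j (e j))‖ ≤ _
    rw [norm_mul, norm_inv, Complex.norm_natCast, inv_mul_le_iff₀ (by positivity)]
    refine h1.trans ?_
    rw [one_mul, mul_comm]
    gcongr
  obtain ⟨f, hf1, hf2⟩ := exists_extension_norm_eq W (g.mkContinuous 1 hg)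
  refine ⟨f, fun d => ?_, ?_, fun x i j => ?_⟩
  · refine (f.le_of_opNorm_le (hf2.trans_le (g.mkContinuous_norm_le zero_le_one hg)) d).trans_eq ?_
    rw [one_mul]
  · have h1 : (1 : CStarMatrix (Fin n) (Fin n) A) ∈ W := fun i j => by
      rw [CStarMatrix.one_apply]
      split_ifs
      exacts [hX, X.zero_mem]
    refine (hf1 ⟨1, h1⟩).trans ?_
    change (n : ℂ)⁻¹ * ∑ i, ∑ j, inner ℂ (e i) (φ ⟨(1 : CStarMatrix (Fin n) (Fin n) A) i j, h1 i j⟩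
      (e j)) = 1
    have h2 : ∀ i j, inner ℂ (e i) (φ ⟨(1 : CStarMatrix (Fin n) (Fin n) A) i j, h1 i j⟩ (e j))
        = if i = j then (1 : ℂ) else 0 := fun i j => by
      by_cases h : i = j
      · subst h
        rw [hφ.map_one _ (CStarMatrix.one_apply_eq i), one_apply_eq_self,
          inner_self_eq_norm_sq_to_K, he.1]
        simp
      · have : (⟨(1 : CStarMatrix (Fin n) (Fin n) A) i j, h1 i j⟩ : X) = 0 :=
          Subtype.ext (CStarMatrix.one_apply_ne h)
        rw [this, map_zero, _root_.zero_apply, inner_zero_right, if_neg h]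
    simp [h2, hn0]
  · have h1 : CStarMatrix.ofMatrix (Matrix.single i j (x : A)) ∈ W := fun k l => by
      rw [CStarMatrix.ofMatrix_apply, Matrix.single_apply]
      split_ifs
      exacts [x.2, X.zero_mem]
    have h2 : f (CStarMatrix.ofMatrix (Matrix.single i j (x : A))) = (n : ℂ)⁻¹ *
      ∑ k, ∑ l, inner ℂ (e k) (φ ⟨Matrix.single i j (x : A) k l, h1 k l⟩ (e l)) := hf1 ⟨_, h1⟩
    have h3 : ∀ k l, φ ⟨Matrix.single i j (x : A) k l, h1 k l⟩
        = if i = k ∧ j = l then φ x else 0 := fun k l => by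
      split_ifs with h
      · exact congrArg φ (Subtype.ext ((Matrix.single_apply ..).trans (if_pos h)))
      · rw [← map_zero φ]
        exact congrArg φ (Subtype.ext ((Matrix.single_apply ..).trans (if_neg h)))
    refine (congrArg (fun z => (n : ℂ) * z) h2).trans ?_
    rw [mul_inv_cancel_left₀ hn0, Finset.sum_eq_single i, Finset.sum_eq_single j]
    · rw [h3, if_pos ⟨rfl, rfl⟩]
    · intro l _ hl
      rw [h3, if_neg (fun h => hl h.2.symm)]
      simp
    · simp
    · intro k _ hk
      refine Finset.sum_eq_zero fun l _ => ?_
      rw [h3, if_neg (fun h => hk h.1.symm)]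
      simp
    · simp

/-- The compression of a unital complete contraction to the span of a finite orthonormal family
extends to the whole C*-algebra. -/
theorem exists_extension_compression {X : Submodule ℂ A} (hX : IsUnital X)
    {φ : X →ₗ[ℂ] H →L[ℂ] H} (hφ : IsUCCOn X φ) {n : ℕ} {e : Fin n → H} (he : Orthonormal ℂ e) :
    ∃ Φ : A →ₗ[ℂ] H →L[ℂ] H, IsCC Φ ∧ ∀ (x : X) ξ η, inner ℂ η (Φ x ξ)
      = inner ℂ (∑ j, inner ℂ (e j) η • e j) (φ x (∑ j, inner ℂ (e j) ξ • e j)) := by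
  obtain _ | m := n
  · refine ⟨0, fun n M => ?_, by simp⟩
    refine matrixNorm_le_of_forall_inner _ (matrixNorm_nonneg M) fun ξ η => ?_
    have := mul_nonneg (mul_nonneg (matrixNorm_nonneg M) (norm_nonneg ξ)) (norm_nonneg η)
    simpa using this
  let _ := CStarAlgebra.spectralOrder A
  have _ := CStarAlgebra.spectralOrderedRing A
  obtain ⟨f, hf, hf1, hfe⟩ := exists_matrix_state hX hφ m.succ_ne_zero he
  obtain ⟨K, _, _, _, ρ, Ω, hρ⟩ := exists_gns f hf hf1
  let E (i j : Fin (m + 1)) (a : A) : CStarMatrix (Fin (m + 1)) (Fin (m + 1)) A :=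
    CStarMatrix.ofMatrix (Matrix.single i j a)
  have hEmul : ∀ i j k (a b : A), E i j a * E j k b = E i k (a * b) := fun i j k a b =>
    Matrix.single_mul_single_same ..
  have hEstar : ∀ i j (a : A), star (E i j a) = E j i (star a) := fun i j a =>
    Matrix.conjTranspose_single ..
  -- Restricting the GNS representation of `M_n(A)` to one corner represents `A`. The vectors `v j`
  -- recover every matrix entry: `⟨v i, σ(a) v j⟩ = f(E i j a)`.
  let σ : A →⋆ₙₐ[ℂ] (K →L[ℂ] K) :=
    { toFun := fun a => ρ (E 0 0 a)
      map_smul' := fun z a => by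
        rw [MonoidHom.id_apply, ← map_smul]
        exact congrArg ρ (Matrix.smul_single ..).symm
      map_zero' := by
        rw [← map_zero ρ]
        exact congrArg ρ (Matrix.single_zero ..)
      map_add' := fun a b => by
        rw [← map_add]
        exact congrArg ρ (Matrix.single_add ..)
      map_mul' := fun a b => by rw [← map_mul, hEmul]
      map_star' := fun a => by rw [← map_star, hEstar] }
  let v (j : Fin (m + 1)) : K := ρ (E 0 j 1) Ω
  have hv : ∀ i j a, inner ℂ (v i) (σ a (v j)) = f (E i j a) := fun i j a => by
    have h1 : inner ℂ (v i) (σ a (v j))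
        = inner ℂ Ω (star (ρ (E 0 i 1)) (ρ (E 0 0 a) (ρ (E 0 j 1) Ω))) := by
      rw [ContinuousLinearMap.star_eq_adjoint, ContinuousLinearMap.adjoint_inner_right]
      rfl
    have h2 : star (ρ (E 0 i 1)) (ρ (E 0 0 a) (ρ (E 0 j 1) Ω))
        = ρ (E i 0 1 * (E 0 0 a * E 0 j 1)) Ω := by
      rw [← map_star, hEstar, star_one, map_mul, map_mul]
      rfl
    rw [h1, h2, hρ, hEmul, hEmul, one_mul, mul_one]
  -- The factor `√n` in `V` undoes the averaging by `1/n` in the state `f`.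
  let c : ℂ := (Real.sqrt (m + 1 : ℕ) : ℂ)
  have hc : c * c = (m + 1 : ℕ) := by
    rw [← Complex.ofReal_mul, Real.mul_self_sqrt (by positivity), Complex.ofReal_natCast]
  let V : H →L[ℂ] K := ∑ j, (innerSL ℂ (e j)).smulRight (c • v j)
  have hV : ∀ ξ, V ξ = ∑ j, (inner ℂ (e j) ξ * c) • v j := fun ξ => by
    simp [V, smul_smul]
  have hVσ : ∀ (x : X) ξ η, inner ℂ (V η) (σ x (V ξ))
      = inner ℂ (∑ j, inner ℂ (e j) η • e j) (φ x (∑ j, inner ℂ (e j) ξ • e j)) := fun x ξ η => by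
    simp only [hV, map_sum, map_smul, sum_inner, inner_sum, inner_smul_left, inner_smul_right, hv,
      map_mul, Finset.mul_sum]
    refine Finset.sum_congr rfl fun i _ => Finset.sum_congr rfl fun j _ => ?_
    rw [← hfe, ← hc, Complex.conj_ofReal]
    ring
  refine ⟨compression σ V, isCC_compression σ V fun ξ => ?_, fun x ξ η => ?_⟩
  · have h1 : σ (1 : A) (V ξ) = V ξ := by
      rw [hV, map_sum]
      refine Finset.sum_congr rfl fun j _ => ?_
      rw [map_smul]
      congr 1
      change (ρ (E 0 0 1) * ρ (E 0 j 1)) Ω = _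
      rw [← map_mul, hEmul, one_mul]
    have h2 := hVσ ⟨1, hX⟩ ξ ξ
    rw [h1, hφ.map_one _ rfl, one_apply_eq_self] at h2
    have h3 : inner ℂ (∑ j, inner ℂ (e j) ξ • e j) (∑ j, inner ℂ (e j) ξ • e j)
        = ((∑ j, ‖inner ℂ (e j) ξ‖ ^ 2 : ℝ) : ℂ) := by
      rw [he.inner_sum]
      push_cast
      exact Finset.sum_congr rfl fun j _ => Complex.conj_mul' _
    rw [h3, inner_self_eq_norm_sq_to_K] at h2
    have h4 : ‖V ξ‖ ^ 2 = ∑ j, ‖inner ℂ (e j) ξ‖ ^ 2 := 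
      Complex.ofReal_injective ((Complex.ofReal_pow ..).trans h2)
    exact le_of_sq_le_sq (h4.trans_le (he.sum_inner_products_le ξ)) (norm_nonneg ξ)
  · rw [inner_compression, hVσ]

/-- Arveson's extension theorem: a unital complete contraction from a unital operator space into
`B(H)` extends to the whole C*-algebra. -/
theorem IsUCCOn.exists_extension {X : Submodule ℂ A} (hX : IsUnital X) {φ : X →ₗ[ℂ] H →L[ℂ] H}
    (hφ : IsUCCOn X φ) : ∃ Φ : A →ₗ[ℂ] H →L[ℂ] H, IsUCC Φ ∧ ∀ x : X, Φ x = φ x := by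
  obtain ⟨ι, b, -⟩ := exists_hilbertBasis ℂ H
  have hF : ∀ F : Finset ι, ∃ Φ : A →ₗ[ℂ] H →L[ℂ] H, IsCC Φ ∧ ∀ (x : X) ξ η,
      inner ℂ η (Φ x ξ)
        = inner ℂ (∑ j ∈ F, inner ℂ (b j) η • b j) (φ x (∑ j ∈ F, inner ℂ (b j) ξ • b j)) :=
    fun F => by
      obtain ⟨Φ, h1, h2⟩ := exists_extension_compression hX hφ
        (b.orthonormal.comp _ (Subtype.val_injective.comp F.equivFin.symm.injective))
      have h3 : ∀ ξ : H, ∑ j, inner ℂ (b (F.equivFin.symm j)) ξ • b (F.equivFin.symm j)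
          = ∑ j ∈ F, inner ℂ (b j) ξ • b j := fun ξ => by
        rw [F.equivFin.symm.sum_comp fun j : F => inner ℂ (b j) ξ • b j]
        exact F.sum_coe_sort fun j => inner ℂ (b j) ξ • b j
      exact ⟨Φ, h1, fun x ξ η => by rw [← h3, ← h3]; exact h2 x ξ η⟩
  choose Φ hΦ hΦx using hF
  obtain ⟨Ψ, hΨ, hlim⟩ := exists_ultrafilter_limit (Ultrafilter.of atTop) Φ hΦ
  -- The finite projections `P_F` tend strongly to `1`, so the compressions `P_F φ(x) P_F` tend
  -- weakly to `φ(x)`.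
  have hP : ∀ ξ : H, Tendsto (fun F : Finset ι => ∑ j ∈ F, inner ℂ (b j) ξ • b j)
      (Ultrafilter.of (atTop : Filter (Finset ι))) (𝓝 ξ) := fun ξ => by
    have := b.hasSum_repr ξ
    simp only [b.repr_apply_apply, HasSum, SummationFilter.unconditional_filter] at this
    exact Tendsto.mono_left this (Ultrafilter.of_le _)
  have hx : ∀ x : X, Ψ x = φ x := fun x => by
    ext ξ
    refine ext_inner_right ℂ fun η => ?_
    refine tendsto_nhds_unique (hlim x ξ η) ?_
    have h1 : ∀ F, inner ℂ (Φ F x ξ) η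
        = inner ℂ (φ x (∑ j ∈ F, inner ℂ (b j) ξ • b j)) (∑ j ∈ F, inner ℂ (b j) η • b j) :=
      fun F => by rw [← inner_conj_symm, hΦx, inner_conj_symm]
    simp only [h1]
    exact Filter.Tendsto.inner (((φ x).continuous.tendsto ξ).comp (hP ξ)) (hP η)
  exact ⟨Ψ, ⟨(hx ⟨1, hX⟩).trans (hφ.map_one _ rfl), hΨ⟩, hx⟩

end Extension

end

section

open Filter Topology

/-! ### A compact semigroup of maps and its rigid elements -/

section Dynamics

variable {H : Type*} [NormedAddCommGroup H] [InnerProductSpace ℂ H] [CompleteSpace H]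

/-- The unital complete contractions of `B(H)` into itself that fix the elements of `F`. -/
def FixingMap (F : Set (H →L[ℂ] H)) : Type _ :=
  {γ : Module.End ℂ (H →L[ℂ] H) // IsUCC γ ∧ ∀ x ∈ F, γ x = x}

namespace FixingMap

variable {F : Set (H →L[ℂ] H)}

/-- The topology of pointwise convergence in the weak operator topology. -/
instance : TopologicalSpace (FixingMap F) :=
  TopologicalSpace.induced (fun γ (p : (H →L[ℂ] H) × H × H) => inner ℂ (γ.1 p.1 p.2.1) p.2.2)
    inferInstance

theorem tendsto_nhds {K : Type*} {l : Filter K} {f : K → FixingMap F} {γ : FixingMap F} :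
    Tendsto f l (𝓝 γ) ↔ ∀ a ξ η,
      Tendsto (fun k => inner ℂ ((f k).1 a ξ) η) l (𝓝 (inner ℂ (γ.1 a ξ) η)) := by
  rw [nhds_induced, tendsto_comap_iff, tendsto_pi_nhds]
  exact ⟨fun h a ξ η => h (a, ξ, η), fun h p => h p.1 p.2.1 p.2.2⟩

theorem continuous_inner (a : H →L[ℂ] H) (ξ η : H) :
    Continuous fun γ : FixingMap F => inner ℂ (γ.1 a ξ) η :=
  continuous_iff_continuousAt.2 fun _ => tendsto_nhds.1 tendsto_id a ξ η

/-- Every ultrafilter has a completely contractive weak operator limit, and fixing `1` or an element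
of `F` passes to that limit. -/
instance : CompactSpace (FixingMap F) where
  isCompact_univ := by
    refine isCompact_iff_ultrafilter_le_nhds.2 fun u _ => ?_
    obtain ⟨Ψ, hΨ, hlim⟩ := exists_ultrafilter_limit u (fun γ : FixingMap F => γ.1)
      fun γ => γ.2.1.contractive
    have hfix : ∀ x, (∀ γ : FixingMap F, γ.1 x = x) → Ψ x = x := fun x hx => by
      ext ξ
      refine ext_inner_right ℂ fun η => tendsto_nhds_unique (hlim x ξ η) ?_
      simp only [hx, tendsto_const_nhds]
    exact ⟨⟨Ψ, ⟨hfix 1 fun γ => γ.2.1.map_one, hΨ⟩, fun x hx => hfix x fun γ => γ.2.2 x hx⟩,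
      trivial, tendsto_nhds.2 hlim⟩

instance : Monoid (FixingMap F) where
  mul γ δ := ⟨γ.1 * δ.1, γ.2.1.comp δ.2.1, fun x hx => by
    rw [Module.End.mul_apply, δ.2.2 x hx, γ.2.2 x hx]⟩
  one := ⟨1, ⟨rfl, fun _ _ => le_rfl⟩, fun _ _ => rfl⟩
  mul_assoc _ _ _ := rfl
  one_mul _ := rfl
  mul_one _ := rfl

theorem mul_apply (γ δ : FixingMap F) (a : H →L[ℂ] H) : (γ * δ).1 a = γ.1 (δ.1 a) := rfl

/-- The mean of the first powers of a map. -/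
def mean (γ : FixingMap F) (n : ℕ) : FixingMap F :=
  ⟨((n + 1 : ℕ) : ℂ)⁻¹ • ∑ k ∈ Finset.range (n + 1), (γ ^ k).1, by
    have hn : ((n + 1 : ℕ) : ℂ) ≠ 0 := Nat.cast_ne_zero.2 n.succ_ne_zero
    have hfix : ∀ x, (∀ δ : FixingMap F, δ.1 x = x) →
        (((n + 1 : ℕ) : ℂ)⁻¹ • ∑ k ∈ Finset.range (n + 1), (γ ^ k).1) x = x := fun x hx => by
      rw [LinearMap.smul_apply, LinearMap.sum_apply]
      simp only [hx, Finset.sum_const, Finset.card_range]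
      rw [← Nat.cast_smul_eq_nsmul ℂ, inv_smul_smul₀ hn]
    refine ⟨⟨hfix 1 fun δ => δ.2.1.map_one, fun m M => ?_⟩, fun x hx => hfix x fun δ => δ.2.2 x hx⟩
    let _ := CStarAlgebra.spectralOrder (H →L[ℂ] H)
    have _ := CStarAlgebra.spectralOrderedRing (H →L[ℂ] H)
    have h1 : CStarMatrix.ofMatrix
        (M.map (((n + 1 : ℕ) : ℂ)⁻¹ • ∑ k ∈ Finset.range (n + 1), (γ ^ k).1))
        = ((n + 1 : ℕ) : ℂ)⁻¹ • ∑ k ∈ Finset.range (n + 1),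
          CStarMatrix.ofMatrix (M.map (γ ^ k).1) := by
      ext1 i j
      let ev : CStarMatrix (Fin m) (Fin m) (H →L[ℂ] H) →ₗ[ℂ] (H →L[ℂ] H) :=
        { toFun := fun N => N i j
          map_add' := fun _ _ => rfl
          map_smul' := fun _ _ => rfl }
      refine Eq.trans ?_ (map_smul ev _ _).symm
      rw [map_sum, CStarMatrix.ofMatrix_apply, Matrix.map_apply, LinearMap.smul_apply,
        LinearMap.sum_apply]
      rfl
    change ‖CStarMatrix.ofMatrix _‖ ≤ _
    rw [h1, norm_smul, norm_inv, Complex.norm_natCast, inv_mul_le_iff₀ (by positivity)]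
    refine (norm_sum_le_of_le _ fun k _ => (γ ^ k).2.1.contractive m M).trans_eq ?_
    rw [Finset.sum_const, Finset.card_range, nsmul_eq_mul]⟩

/-- The sum telescopes, so the means are invariant under right multiplication by `γ` up to an error
of order `1/n`. -/
theorem mean_mul_mul_sub (γ : FixingMap F) (n : ℕ) (a : H →L[ℂ] H) :
    (mean γ n * γ).1 (γ.1 a) - (mean γ n * γ).1 a
      = ((n + 1 : ℕ) : ℂ)⁻¹ • ((γ ^ (n + 2)).1 a - γ.1 a) := by
  have h1 : ∀ b, (mean γ n).1 b = ((n + 1 : ℕ) : ℂ)⁻¹ •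
      ∑ k ∈ Finset.range (n + 1), (γ ^ k).1 b := fun b => by
    simp [mean]
  have h2 : ∀ k, (γ ^ k).1 (γ.1 a) = (γ ^ (k + 1)).1 a := fun k => by
    rw [pow_succ, mul_apply]
  have h3 : ∀ k, (γ ^ k).1 (γ.1 (γ.1 a)) = (γ ^ (k + 2)).1 a := fun k => by
    rw [pow_succ, pow_succ, mul_apply, mul_apply]
  rw [mul_apply, mul_apply, h1, h1, ← smul_sub, ← Finset.sum_sub_distrib]
  simp only [h2, h3]
  rw [Finset.sum_range_sub fun k => (γ ^ (k + 1)).1 a, zero_add, pow_one]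

/-- A minimal closed left ideal of the compact semigroup of the maps that fix `F`. -/
theorem exists_minimal_leftIdeal : ∃ L : Set (FixingMap F),
    Minimal (fun L : Set (FixingMap F) => IsClosed L ∧ L.Nonempty ∧ ∀ γ, ∀ δ ∈ L, γ * δ ∈ L) L := by
  refine zorn_superset {L : Set (FixingMap F) | IsClosed L ∧ L.Nonempty ∧
    ∀ γ, ∀ δ ∈ L, γ * δ ∈ L} fun c hcs hc => ?_
  refine ⟨⋂₀ c, ⟨isClosed_sInter fun t ht => (hcs ht).1, ?_, fun γ δ hδ => ?_⟩, fun s hs =>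
    Set.sInter_subset_of_mem hs⟩
  · obtain rfl | hne := c.eq_empty_or_nonempty
    · rw [Set.sInter_empty]
      exact ⟨1, trivial⟩
    have := hne.to_subtype
    rw [Set.sInter_eq_iInter]
    exact IsCompact.nonempty_iInter_of_directed_nonempty_isCompact_isClosed _
      (DirectedOn.directed_val (IsChain.directedOn hc.symm)) (fun i => (hcs i.prop).2.1)
      (fun i => (hcs i.prop).1.isCompact) fun i => (hcs i.prop).1
  · exact Set.mem_sInter.2 fun t ht => (hcs ht).2.2 γ δ (Set.mem_sInter.1 hδ t ht)

/-- In a minimal closed left ideal, every element is a left zero. -/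
theorem mul_eq_left_of_minimal {L : Set (FixingMap F)}
    (hL : Minimal (fun L : Set (FixingMap F) => IsClosed L ∧ L.Nonempty ∧
      ∀ γ, ∀ δ ∈ L, γ * δ ∈ L) L) {φ : FixingMap F} (hφ : φ ∈ L) :
    ∀ δ ∈ L, δ * φ = δ := by
  obtain ⟨⟨hcl, -, hmul⟩, hmin⟩ := hL
  -- Take a limit point of `mean φ n * φ`. The extra factor `φ` puts these maps in the left ideal,
  -- since `mean φ n` also contains the zeroth power.
  have key : ∃ e ∈ L, e * φ = e := by
    obtain ⟨e, -, he⟩ := isCompact_iff_ultrafilter_le_nhds.1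
      (isCompact_univ (X := FixingMap F))
      ((Ultrafilter.of (atTop : Filter ℕ)).map fun n => mean φ n * φ) (by simp)
    have he' : Tendsto (fun n => mean φ n * φ) (Ultrafilter.of (atTop : Filter ℕ)) (𝓝 e) := he
    refine ⟨e, hcl.mem_of_tendsto he' (Eventually.of_forall fun n => hmul _ _ hφ), ?_⟩
    refine Subtype.ext (LinearMap.ext fun a => ?_)
    rw [mul_apply]
    ext ξ
    refine ext_inner_right ℂ fun η => ?_
    rw [← sub_eq_zero]
    refine tendsto_nhds_unique ((tendsto_nhds.1 he' (φ.1 a) ξ η).sub (tendsto_nhds.1 he' a ξ η)) ?_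
    simp only [← inner_sub_left, ← _root_.sub_apply, mean_mul_mul_sub]
    refine Tendsto.mono_left (squeeze_zero_norm (a := fun n : ℕ =>
      (2 * ‖a‖ * ‖ξ‖ * ‖η‖) / ((n : ℝ) + 1)) (fun n => ?_) ?_) (Ultrafilter.of_le _)
    · rw [_root_.smul_apply, inner_smul_left, norm_mul, RCLike.norm_conj, norm_inv,
        Complex.norm_natCast, inv_mul_eq_div, Nat.cast_add_one]
      gcongr
      refine (norm_inner_le_norm _ _).trans ?_
      gcongr
      refine ContinuousLinearMap.le_of_opNorm_le _ ?_ ξ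
      rw [two_mul]
      exact (norm_sub_le _ _).trans
        (add_le_add ((φ ^ (n + 2)).2.1.norm_apply_le a) (φ.2.1.norm_apply_le a))
    · exact tendsto_const_nhds.div_atTop
        (tendsto_atTop_add_const_right _ _ tendsto_natCast_atTop_atTop)
  -- The right-hand side is again a nonempty closed left ideal, so minimality makes it all of `L`.
  have hLφ : L ⊆ {δ ∈ L | δ * φ = δ} := by
    refine hmin ⟨?_, ?_, ?_⟩ fun δ hδ => hδ.1
    · have : {δ ∈ L | δ * φ = δ} = L ∩ ⋂ a, ⋂ ξ, ⋂ η,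
          {δ : FixingMap F | inner ℂ (δ.1 (φ.1 a) ξ) η = inner ℂ (δ.1 a ξ) η} := by
        ext δ
        simp only [Set.mem_ofPred_eq, Set.mem_inter_iff, Set.mem_iInter, and_congr_right_iff]
        refine fun _ => ⟨fun h a ξ η => by rw [← mul_apply, h], fun h => ?_⟩
        refine Subtype.ext (LinearMap.ext fun a => ?_)
        ext ξ
        exact ext_inner_right ℂ (h a ξ)
      rw [this]
      exact hcl.inter (isClosed_iInter fun a => isClosed_iInter fun ξ => isClosed_iInter fun η =>
        isClosed_eq (continuous_inner _ _ _) (continuous_inner _ _ _))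
    · exact key
    · exact fun γ δ hδ => ⟨hmul γ δ hδ.1, by rw [mul_assoc, hδ.2]⟩
  exact fun δ hδ => (hLφ hδ).2

/-- There is a map in the semigroup that is rigid with respect to `F`. -/
theorem exists_rigid : ∃ φ : FixingMap F, ∀ γ : FixingMap F, φ * γ * φ = φ := by
  obtain ⟨L, hL⟩ := exists_minimal_leftIdeal (F := F)
  obtain ⟨φ, hφ⟩ := hL.1.2.1
  refine ⟨φ, fun γ => ?_⟩
  rw [mul_assoc]
  exact mul_eq_left_of_minimal hL (hL.1.2.2 γ φ hφ) φ hφ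

end FixingMap

end Dynamics

end

/-! ### Multiplicative properties of idempotent unital complete contractions -/

section ChoiEffros

variable {H : Type*} [NormedAddCommGroup H] [InnerProductSpace ℂ H] [CompleteSpace H]

theorem IsUCC.star_mul_self_le {A : Type*} [CStarAlgebra A] {φ : A →ₗ[ℂ] H →L[ℂ] H}
    (hφ : IsUCC φ) (a : A) : star (φ a) * φ a ≤ φ (star a * a) := by
  rw [ContinuousLinearMap.le_def, ContinuousLinearMap.isPositive_def']
  refine ⟨((hφ.isSelfAdjoint_map (.star_mul_self a)).sub (.star_mul_self (φ a))), fun ξ => ?_⟩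
  have h1 := hφ.norm_sq_le a ξ
  have h2 : (inner ℂ ((star (φ a) * φ a) ξ) ξ).re = ‖φ a ξ‖ ^ 2 := by
    change (inner ℂ (star (φ a) (φ a ξ)) ξ).re = _
    rw [ContinuousLinearMap.star_eq_adjoint, ContinuousLinearMap.adjoint_inner_left,
      inner_self_eq_norm_sq_to_K]
    norm_cast
  rw [ContinuousLinearMap.reApplyInnerSelf_apply, _root_.sub_apply, inner_sub_left, map_sub]
  change 0 ≤ _ - (inner ℂ ((star (φ a) * φ a) ξ) ξ).re
  rw [h2, ← inner_conj_symm, RCLike.conj_re]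
  exact sub_nonneg.2 h1

variable {φ ψ : (H →L[ℂ] H) →ₗ[ℂ] H →L[ℂ] H}

/-- Positivity is read off from the Schwarz inequality: `φ(c* c) ≥ φ(c)* φ(c) ≥ 0`. -/
theorem IsUCC.map_mono (hφ : IsUCC φ) {a b : H →L[ℂ] H} (h : a ≤ b) : φ a ≤ φ b := by
  obtain ⟨c, hc⟩ := CStarAlgebra.nonneg_iff_eq_star_mul_self.1 (sub_nonneg.2 h)
  rw [← sub_nonneg, ← map_sub, hc]
  exact (star_mul_self_nonneg (φ c)).trans (hφ.star_mul_self_le c)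

/-- Apply `φ` to the Schwarz inequality for `r + tk`. The term `φ(r* r)` cancels, leaving an
expression in `t` that is nonnegative for all complex `t` and has no constant term; its linear part
must vanish. -/
theorem map_star_mul_eq_zero (hφ : IsUCC φ) (hφφ : ∀ a, φ (φ a) = φ a) {r k : H →L[ℂ] H}
    (hr : φ r = r) (hk : φ k = 0) : φ (star r * k) = 0 := by
  have key : ∀ t : ℂ, 0 ≤ t • φ (star r * k) + star t • star (φ (star r * k))
      + (star t * t) • φ (star k * k) := fun t => by
    have h1 := hφ.map_mono (hφ.star_mul_self_le (r + t • k))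
    rw [hφφ, map_add, map_smul, hk, smul_zero, add_zero, hr] at h1
    rw [← sub_nonneg, ← map_sub] at h1
    have h2 : star (r + t • k) * (r + t • k) - star r * r
        = t • (star r * k) + star t • star (star r * k) + (star t * t) • (star k * k) := by
      simp only [star_add, star_smul, star_mul, star_star, add_mul, mul_add, smul_mul_assoc,
        mul_smul_comm, mul_smul, smul_add, smul_comm t (star t)]
      abel
    rwa [h2, map_add, map_add, map_smul, map_smul, map_smul, hφ.map_star] at h1
  set w := φ (star r * k)
  set p := φ (star k * k)
  have hw : ∀ ξ, inner ℂ (w ξ) ξ = 0 := fun ξ => by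
    set z : ℂ := inner ℂ (w ξ) ξ with hz
    set q : ℝ := (inner ℂ (p ξ) ξ).re
    have h1 : ∀ s : ℝ, 0 ≤ s * (2 * ‖z‖ ^ 2) + s ^ 2 * (‖z‖ ^ 2 * q) := fun s => by
      -- Choosing `t = s z` aligns the phase, so that the linear term becomes `2s|z|²` with `s`
      -- real.
      have h2 := ContinuousLinearMap.nonneg_iff_isPositive _ |>.1 (key (s * z))
      have h3 := h2.re_inner_nonneg_left ξ
      have h4 : inner ℂ (star w ξ) ξ = star z := by
        rw [ContinuousLinearMap.star_eq_adjoint, ContinuousLinearMap.adjoint_inner_left, hz,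
          ← inner_conj_symm]
        rfl
      simp only [_root_.add_apply, _root_.smul_apply, inner_add_left, inner_smul_left, h4,
        ← hz] at h3
      have h5 : star (s * z) * z + star (star (s * z)) * star z
          = ((s * (2 * ‖z‖ ^ 2) : ℝ) : ℂ) := by
        have := Complex.conj_mul' z
        push_cast
        rw [star_star, star_mul', Complex.star_def, Complex.conj_ofReal]
        linear_combination (2 * s : ℂ) * this
      have h6 : star (star (s * z) * (s * z)) = ((s ^ 2 * ‖z‖ ^ 2 : ℝ) : ℂ) := by
        have := Complex.conj_mul' z
        push_cast
        rw [star_mul', star_star, star_mul', Complex.star_def, Complex.conj_ofReal]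
        linear_combination (s ^ 2 : ℂ) * this
      change 0 ≤ (star (s * z) * z + star (star (s * z)) * star z
        + star (star (s * z) * (s * z)) * inner ℂ (p ξ) ξ).re at h3
      rw [h5, h6, Complex.add_re, Complex.ofReal_re, Complex.re_ofReal_mul] at h3
      linarith
    by_contra h0
    have h2 : 0 < ‖z‖ ^ 2 := by have := norm_pos_iff.2 h0; positivity
    -- This `s` is small enough that the quadratic term cannot compensate the negative linear one.
    have h3 := h1 (-(1 + |q|)⁻¹)
    have h4 : 0 < (1 + |q|)⁻¹ := by positivity
    have h5 : (1 + |q|)⁻¹ * q ≤ 1 := by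
      rw [inv_mul_le_iff₀ (by positivity)]
      linarith [le_abs_self q]
    nlinarith [mul_pos h4 h2, mul_le_mul_of_nonneg_left h5 (mul_pos h4 h2).le]
  exact ContinuousLinearMap.coe_injective (inner_map_self_eq_zero _ |>.1 hw)

/-- The element `φ(a) - a` lies in `ker φ`, which `φ`-fixed elements multiply into itself. This is
the Choi–Effros identity. -/
theorem map_mul_map (hφ : IsUCC φ) (hφφ : ∀ a, φ (φ a) = φ a) {r : H →L[ℂ] H}
    (hr : φ r = r) (a : H →L[ℂ] H) : φ (r * φ a) = φ (r * a) := by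
  have h1 : φ (star r) = star r := by rw [hφ.map_star, hr]
  have h2 := map_star_mul_eq_zero hφ hφφ h1 (k := φ a - a) (by rw [map_sub, hφφ, sub_self])
  rwa [star_star, mul_sub, map_sub, sub_eq_zero] at h2

/-- Applying `ψ` to `r* r ≤ φ(r* r)` gives `ψ(r* r) ≤ φ(r* r)`, as `ψ` fixes the range of `φ`. The
roles are symmetric. -/
theorem map_star_mul_self_eq (hφ : IsUCC φ) (hψ : IsUCC ψ) (hφψ : ∀ a, φ (ψ a) = ψ a)
    (hψφ : ∀ a, ψ (φ a) = φ a) {r : H →L[ℂ] H} (hr : φ r = r) :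
    φ (star r * r) = ψ (star r * r) := by
  have hr' : ψ r = r := by rw [← hr, hψφ]
  have h1 := hψ.map_mono (hφ.star_mul_self_le r)
  have h2 := hφ.map_mono (hψ.star_mul_self_le r)
  rw [hr, hψφ] at h1
  rw [hr', hφψ] at h2
  exact le_antisymm h2 h1

/-- Polarization of the case `x* x`, with `x = r* + s` and `x = r* + i s`. -/
theorem map_mul_eq (hφ : IsUCC φ) (hψ : IsUCC ψ) (hφψ : ∀ a, φ (ψ a) = ψ a)
    (hψφ : ∀ a, ψ (φ a) = φ a) {r s : H →L[ℂ] H} (hr : φ r = r) (hs : φ s = s) :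
    φ (r * s) = ψ (r * s) := by
  have hr' : φ (star r) = star r := by rw [hφ.map_star, hr]
  let Δ := φ - ψ
  have key : ∀ x, φ x = x → Δ (star x * x) = 0 := fun x hx =>
    sub_eq_zero.2 (map_star_mul_self_eq hφ hψ hφψ hψφ hx)
  have h1 := key _ hr'
  have h2 := key _ hs
  have h3 := key (star r + s) (by rw [map_add, hr', hs])
  have h4 := key (star r + Complex.I • s) (by rw [map_add, map_smul, hr', hs])
  have h5 : star (star r + Complex.I • s) * (star r + Complex.I • s)
      = star (star r) * star r + star s * s + Complex.I • (r * s - star s * star r) := by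
    simp only [star_add, star_smul, star_star, add_mul, mul_add, smul_mul_assoc, mul_smul_comm,
      Complex.star_def, Complex.conj_I, smul_sub, smul_add, smul_neg, neg_smul, neg_mul, smul_smul,
      Complex.I_mul_I, neg_neg, one_smul]
    abel
  have h6 : star (star r + s) * (star r + s)
      = star (star r) * star r + star s * s + (r * s + star s * star r) := by
    simp only [star_add, star_star, add_mul, mul_add]
    abel
  rw [h6, map_add, map_add, h1, h2, zero_add, zero_add, map_add] at h3
  rw [h5, map_add, map_add, h1, h2, zero_add, zero_add, map_smul, smul_eq_zero_iff_right
    Complex.I_ne_zero, map_sub] at h4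
  have h7 : (2 : ℂ) • Δ (r * s) = 0 := by
    rw [two_smul]
    nth_rewrite 2 [sub_eq_zero.1 h4]
    exact h3
  exact sub_eq_zero.1 ((smul_eq_zero_iff_right two_ne_zero).1 h7)

/-- Two idempotent unital complete contractions with the same range agree on products with
elements of the range. -/
theorem map_mul_eq_of_eq (hφ : IsUCC φ) (hψ : IsUCC ψ) (hφψ : ∀ a, φ (ψ a) = ψ a)
    (hψφ : ∀ a, ψ (φ a) = φ a) {r a : H →L[ℂ] H} (hr : φ r = r) (ha : φ a = ψ a) :
    φ (r * a) = ψ (r * a) := by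
  have hφφ : ∀ a, φ (φ a) = φ a := fun a => by rw [← hψφ a, hφψ]
  have hψψ : ∀ a, ψ (ψ a) = ψ a := fun a => by rw [← hφψ a, hψφ]
  rw [← map_mul_map hφ hφφ hr, map_mul_eq hφ hψ hφψ hψφ hr (hφφ a), ha,
    map_mul_map hψ hψψ (by rw [← hr, hψφ])]

/-- The induction carries `π c` and its adjoint together, because the adjoin is closed under the
involution; closedness of `N` then passes to limits in `c`. -/
theorem mul_mem_of_generates {C B : Type*} [CStarAlgebra C] [CStarAlgebra B] {S : Set C}
    (hS : Generates S) (π : C →⋆ₐ[ℂ] B) (N : Submodule ℂ B) (hN : IsClosed (N : Set B))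
    (h : ∀ s ∈ S, ∀ a ∈ N, π s * a ∈ N ∧ star (π s) * a ∈ N) (c : C) {a : B} (ha : a ∈ N) :
    π c * a ∈ N := by
  have h1 : ∀ c ∈ StarAlgebra.adjoin ℂ S, ∀ a ∈ N, π c * a ∈ N ∧ star (π c) * a ∈ N := by
    intro c hc
    induction hc using StarAlgebra.adjoin_induction with
    | mem x hx => exact h x hx
    | algebraMap z =>
      intro a ha
      rw [AlgHomClass.commutes, ← algebraMap_star_comm, ← Algebra.smul_def, ← Algebra.smul_def]
      exact ⟨N.smul_mem _ ha, N.smul_mem _ ha⟩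
    | add x y _ _ hx hy =>
      intro a ha
      rw [map_add, star_add, add_mul, add_mul]
      exact ⟨N.add_mem (hx a ha).1 (hy a ha).1, N.add_mem (hx a ha).2 (hy a ha).2⟩
    | mul x y _ _ hx hy =>
      intro a ha
      rw [map_mul, star_mul, mul_assoc, mul_assoc]
      exact ⟨(hx _ (hy a ha).1).1, (hy _ (hx a ha).2).2⟩
    | star x _ hx =>
      intro a ha
      rw [map_star, star_star]
      exact (hx a ha).symm
  have hc : c ∈ (StarAlgebra.adjoin ℂ S).topologicalClosure := hS ▸ StarSubalgebra.mem_top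
  have hcl : IsClosed {c | π c * a ∈ N} :=
    hN.preimage ((continuous_starAlgHom π).mul continuous_const)
  exact hcl.closure_subset_iff.2 (fun c hc => (h1 c hc a ha).1) hc

end ChoiEffros

/-! ### The Šilov ideal from a rigid map -/

section Silov

variable {A : Type u} [CStarAlgebra A]
variable {H : Type*} [NormedAddCommGroup H] [InnerProductSpace ℂ H] [CompleteSpace H]

theorem IsUCIS.norm_map {X : Submodule ℂ A} {B : Type*} [CStarAlgebra B] {j : X →ₗ[ℂ] B}
    (hj : IsUCIS X j) (x : X) : ‖j x‖ = ‖(x : A)‖ := by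
  rw [← matrixNorm_fin_one, ← matrixNorm_fin_one (x : A)]
  exact hj.isometric 1 (Matrix.of fun _ _ => x)

theorem IsUCIS.injective {X : Submodule ℂ A} {B : Type*} [CStarAlgebra B] {j : X →ₗ[ℂ] B}
    (hj : IsUCIS X j) : Function.Injective j := by
  refine (injective_iff_map_eq_zero j).2 fun x hx => ?_
  have := hj.norm_map x
  rw [hx, norm_zero, eq_comm, norm_eq_zero] at this
  exact Subtype.ext this

/-- Unital complete contractions into `B(H)` extend along unital complete isometries. -/
theorem IsUCIS.exists_extension {X : Submodule ℂ A} (hX : IsUnital X) {B : Type*} [CStarAlgebra B]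
    {j : X →ₗ[ℂ] B} (hj : IsUCIS X j) {φ : X →ₗ[ℂ] H →L[ℂ] H} (hφ : IsUCCOn X φ) :
    ∃ Φ : B →ₗ[ℂ] H →L[ℂ] H, IsUCC Φ ∧ ∀ x, Φ (j x) = φ x := by
  let e := LinearEquiv.ofInjective j hj.injective
  have he : ∀ x, ((e x : LinearMap.range j) : B) = j x := fun x => rfl
  have hj1 : j ⟨1, hX⟩ = 1 := hj.map_one _ rfl
  have hφe : IsUCCOn (LinearMap.range j) (φ ∘ₗ e.symm.toLinearMap) := by
    refine ⟨fun y hy => ?_, fun n M => ?_⟩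
    · have : y = e ⟨1, hX⟩ := Subtype.ext (by rw [hy, he, hj1])
      rw [this]
      simpa using hφ.map_one ⟨1, hX⟩ rfl
    · have h3 := (hφ.contractive n (M.map e.symm)).trans_eq (hj.isometric n (M.map e.symm)).symm
      refine h3.trans_eq (congrArg matrixNorm ?_)
      ext i k
      simp [← he]
  obtain ⟨Φ, h1, h2⟩ := hφe.exists_extension (LinearMap.mem_range.2 ⟨_, hj1⟩)
  refine ⟨Φ, h1, fun x => ?_⟩
  rw [← he, h2]
  exact congrArg φ (e.symm_apply_apply x)

variable {C : Type u} [CStarAlgebra C]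

theorem isUCIS_of_injective (X : Submodule ℂ C) {B : Type*} [CStarAlgebra B] (π : C →⋆ₐ[ℂ] B)
    (hπ : Function.Injective π) : IsUCIS X (π.toAlgHom.toLinearMap ∘ₗ X.subtype) where
  map_one _ he := (congrArg π he).trans (map_one π)
  isometric _ M := matrixNorm_map_of_injective (π : C →⋆ₙₐ[ℂ] B) hπ (M.map ((↑) : X → C))

theorem IsUCC.isUCCOn {φ : C →ₗ[ℂ] H →L[ℂ] H} (hφ : IsUCC φ) (X : Submodule ℂ C) :
    IsUCCOn X (φ ∘ₗ X.subtype) where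
  map_one _ he := (congrArg φ he).trans hφ.map_one
  contractive n M := hφ.contractive n (M.map ((↑) : X → C))

/-- Existence of the Šilov ideal. -/
theorem exists_isSilovIdeal {X : Submodule ℂ C} (hX : IsUnital X) (hC : Generates (X : Set C)) :
    ∃ (I : Ideal C) (_ : I.IsTwoSided) (_ : IsClosed (I : Set C)), IsSilovIdeal X I := by
  obtain ⟨H, _, _, _, π, hπ⟩ := exists_faithful_representation C
  obtain ⟨⟨φ, hφ, hφX⟩, hrigid⟩ := FixingMap.exists_rigid (F := π '' X)
  have hrig : ∀ γ : Module.End ℂ (H →L[ℂ] H), IsUCC γ → (∀ x ∈ X, γ (π x) = π x) →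
      ∀ a, φ (γ (φ a)) = φ a := fun γ h1 h2 a => by
    have := hrigid ⟨γ, h1, by rintro _ ⟨x, hx, rfl⟩; exact h2 x hx⟩
    exact LinearMap.congr_fun (congrArg Subtype.val this) a
  have hφφ : ∀ a, φ (φ a) = φ a := hrig 1 ⟨rfl, fun _ _ => le_rfl⟩ fun _ _ => rfl
  replace hφX : ∀ x ∈ X, φ (π x) = π x := fun x hx => hφX _ ⟨x, hx, rfl⟩
  have hφX' : ∀ x ∈ X, φ (star (π x)) = star (π x) := fun x hx => by rw [hφ.map_star, hφX x hx]
  have hφc : Continuous φ := AddMonoidHomClass.continuous_of_bound φ 1 fun a => by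
    simpa using hφ.norm_apply_le a
  have hleft : ∀ c d, φ (π d) = 0 → φ (π (c * d)) = 0 := fun c d hd => by
    rw [map_mul]
    refine mul_mem_of_generates hC π (LinearMap.ker φ) (isClosed_singleton.preimage hφc)
      (fun x hx a ha => ⟨?_, ?_⟩) c hd
    · rw [LinearMap.mem_ker, ← map_mul_map hφ hφφ (hφX x hx), LinearMap.mem_ker.1 ha, mul_zero,
        map_zero]
    · rw [LinearMap.mem_ker, ← map_mul_map hφ hφφ (hφX' x hx), LinearMap.mem_ker.1 ha, mul_zero,
        map_zero]
  have hstar : ∀ d, φ (π d) = 0 → φ (π (star d)) = 0 := fun d hd => by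
    rw [map_star, hφ.map_star, hd, star_zero]
  let I : Ideal C :=
    { carrier := {c | φ (π c) = 0}
      add_mem' := fun {a b} ha hb => by
        change φ (π (a + b)) = 0
        rw [map_add, map_add, ha, hb, add_zero]
      zero_mem' := by simp
      smul_mem' := fun c d hd => hleft c d hd }
  have hI2 : I.IsTwoSided := ⟨fun {d} c hd => by
    have := hstar _ (hleft (star c) (star d) (hstar d hd))
    rwa [star_mul, star_star, star_star] at this⟩
  have hIc : IsClosed (I : Set C) :=
    isClosed_singleton.preimage (hφc.comp (continuous_starAlgHom π))
  refine ⟨I, hI2, hIc, ⟨hI2, hIc, ?_, fun n M => le_antisymm ?_ ?_⟩, ?_⟩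
  · exact fun e he => (congrArg _ he).trans (map_one (CStarQuotient.mk I))
  · exact matrixNorm_map_le (CStarQuotient.mk I : C →⋆ₙₐ[ℂ] C ⧸ I) (M.map ((↑) : X → C))
  · refine le_of_forall_pos_le_add fun ε hε => ?_
    obtain ⟨N, hN, hlt⟩ := exists_lift_matrixNorm_lt (CStarQuotient.mk I) (M.map ((↑) : X → C)) hε
    -- `φ ∘ π` kills `I` and equals `π` on `X`, so it recovers `π(M)` from any lift `N` of the class
    -- of `M`.
    have h1 : (N.map π).map φ = (M.map ((↑) : X → C)).map π := by
      ext1 i j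
      have h2 : N i j - (M i j : C) ∈ I := Ideal.Quotient.eq.1 (congrFun (congrFun hN i) j)
      have h3 : φ (π (N i j - (M i j : C))) = 0 := h2
      rw [map_sub, map_sub, sub_eq_zero, hφX _ (M i j).2] at h3
      exact h3
    calc matrixNorm (M.map ((↑) : X → C))
        = matrixNorm ((M.map ((↑) : X → C)).map π) :=
          (matrixNorm_map_of_injective (π : C →⋆ₙₐ[ℂ] (H →L[ℂ] H)) hπ _).symm
      _ = matrixNorm ((N.map π).map φ) := by rw [h1]
      _ ≤ matrixNorm (N.map π) := hφ.contractive n _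
      _ ≤ matrixNorm N := matrixNorm_map_le (π : C →⋆ₙₐ[ℂ] (H →L[ℂ] H)) N
      _ ≤ _ := hlt.le
  · rintro J ⟨_, _, hJ⟩ c hc
    obtain ⟨Θ, hΘ, hΘX⟩ := hJ.exists_extension hX (isUCIS_of_injective X π hπ).isUCCOn
    have hΘq := hΘ.comp (IsUCC.of_starAlgHom (CStarQuotient.mk J))
    -- Extending along `π`, regarded as a complete isometry of all of `C`, yields `γ` with `γ ∘ π =
    -- Θ ∘ q_J`.
    obtain ⟨γ, hγ, hγC⟩ := (isUCIS_of_injective ⊤ π hπ).exists_extension Submodule.mem_top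
      (hΘq.isUCCOn ⊤)
    replace hγC : ∀ c, γ (π c) = Θ (CStarQuotient.mk J c) := fun c => hγC ⟨c, trivial⟩
    have hγX : ∀ x ∈ X, γ (π x) = π x := fun x hx => (hγC x).trans (hΘX ⟨x, hx⟩)
    have h1 : ∀ a, φ ((φ ∘ₗ γ) a) = (φ ∘ₗ γ) a := fun a => hφφ _
    have h2 : ∀ a, (φ ∘ₗ γ) (φ a) = φ a := hrig γ hγ hγX
    have hclosed : IsClosed (LinearMap.ker (φ - φ ∘ₗ γ) : Set (H →L[ℂ] H)) := by
      have hγc : Continuous γ := AddMonoidHomClass.continuous_of_bound γ 1 fun a => by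
        simpa using hγ.norm_apply_le a
      exact isClosed_singleton.preimage (hφc.sub (hφc.comp hγc))
    -- The set where `φ` and `φγ` agree contains `1` and is stable under left multiplication by
    -- `π(X)` and `π(X)*`, so it contains `π(C)`.
    have h3 := mul_mem_of_generates hC π _ hclosed (fun x hx a ha => ⟨?_, ?_⟩) c (a := 1)
      (by simp [hφ.map_one, hγ.map_one])
    · rw [mul_one, LinearMap.mem_ker, LinearMap.sub_apply, sub_eq_zero, LinearMap.comp_apply,
        hγC] at h3
      have h4 : CStarQuotient.mk J c = 0 := Ideal.Quotient.eq_zero_iff_mem.2 hc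
      rw [h4, map_zero, map_zero] at h3
      exact h3
    · rw [LinearMap.mem_ker, LinearMap.sub_apply, sub_eq_zero] at ha ⊢
      exact map_mul_eq_of_eq hφ (hφ.comp hγ) h1 h2 (hφX x hx) ha
    · rw [LinearMap.mem_ker, LinearMap.sub_apply, sub_eq_zero] at ha ⊢
      exact map_mul_eq_of_eq hφ (hφ.comp hγ) h1 h2 (hφX' x hx) ha

end Silov

/-! ### C*-covers and the universal property -/

section Covers

/-- `ρ` factors through the quotient by its kernel, so the quotient matrix norms on `X` lie between
those in `A` and those in `C`, which coincide. -/
theorem isBoundaryIdeal_ker {C A : Type*} [CStarAlgebra C] [CStarAlgebra A] {X : Submodule ℂ C}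
    (ρ : C →⋆ₐ[ℂ] A) (hρ : IsUCIS X (ρ.toAlgHom.toLinearMap ∘ₗ X.subtype)) :
    IsBoundaryIdeal X (RingHom.ker ρ) := by
  refine ⟨inferInstance, inferInstance, fun e he => ?_, fun n M => le_antisymm ?_ ?_⟩
  · exact (congrArg _ he).trans (map_one (CStarQuotient.mk (RingHom.ker ρ)))
  · exact matrixNorm_map_le (CStarQuotient.mk (RingHom.ker ρ) : C →⋆ₙₐ[ℂ] C ⧸ RingHom.ker ρ)
      (M.map ((↑) : X → C))
  · obtain ⟨τ, hτ, -⟩ := exists_isometry_quotient_ker ρ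
    refine (hρ.isometric n M).symm.trans_le ?_
    refine le_trans (le_of_eq (congrArg matrixNorm ?_)) (matrixNorm_map_le
      (τ : (C ⧸ RingHom.ker ρ) →⋆ₙₐ[ℂ] A) (M.map (quotientMap X (RingHom.ker ρ))))
    ext1 i j
    exact (hτ _).symm

/-- The map `M_n(A × B) → M_n(A) × M_n(B)` is an injective *-homomorphism, hence isometric for the
maximum norm. -/
theorem matrixNorm_prod {A B : Type*} [CStarAlgebra A] [CStarAlgebra B] {n : ℕ}
    (M : Matrix (Fin n) (Fin n) (A × B)) :
    matrixNorm M = max (matrixNorm (M.map Prod.fst)) (matrixNorm (M.map Prod.snd)) := by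
  let _ := CStarAlgebra.spectralOrder A
  have _ := CStarAlgebra.spectralOrderedRing A
  let _ := CStarAlgebra.spectralOrder B
  have _ := CStarAlgebra.spectralOrderedRing B
  let _ := CStarAlgebra.spectralOrder (A × B)
  have _ := CStarAlgebra.spectralOrderedRing (A × B)
  let π := NonUnitalStarAlgHom.prod
    (CStarMatrix.mapₙₐ (n := Fin n) (NonUnitalStarAlgHom.fst ℂ A B))
    (CStarMatrix.mapₙₐ (n := Fin n) (NonUnitalStarAlgHom.snd ℂ A B))
  refine (NonUnitalStarAlgHom.norm_map π (fun S T h => ?_) (CStarMatrix.ofMatrix M)).symm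
  ext1 i j
  exact Prod.ext (congrFun (congrFun (congrArg Prod.fst h) i) j)
    (congrFun (congrFun (congrArg Prod.snd h) i) j)

variable {C : Type*} [CStarAlgebra C] {X : Submodule ℂ C}

theorem IsUCIS.comp_range {D B : Type*} [CStarAlgebra D] [CStarAlgebra B] {k : X →ₗ[ℂ] D}
    (hk : IsUCIS X k) {f : D →ₗ[ℂ] B} (hf : IsUCIS (LinearMap.range k) (f ∘ₗ Submodule.subtype _)) :
    IsUCIS X (f ∘ₗ k) where
  map_one e he := hf.map_one ⟨k e, e, rfl⟩ (hk.map_one e he)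
  isometric n M := (hf.isometric n (M.map k.rangeRestrict)).trans (hk.isometric n M)

theorem IsUCIS.range_of_comp (hX : IsUnital X) {D B : Type*} [CStarAlgebra D] [CStarAlgebra B]
    {k : X →ₗ[ℂ] D} (hk : IsUCIS X k) {f : D →ₗ[ℂ] B} (hf : IsUCIS X (f ∘ₗ k)) :
    IsUCIS (LinearMap.range k) (f ∘ₗ Submodule.subtype _) where
  map_one e he := by
    have h1 : (e : D) = k ⟨1, hX⟩ := he.trans (hk.map_one _ rfl).symm
    exact (congrArg f h1).trans (hf.map_one ⟨1, hX⟩ rfl)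
  isometric n M := by
    choose N hN using fun i j => (M i j).2
    have h1 : M = (Matrix.of N).map k.rangeRestrict := by
      ext i j
      exact (hN i j).symm
    rw [h1]
    exact (hf.isometric n (Matrix.of N)).trans (hk.isometric n (Matrix.of N)).symm

/-- Any two C*-covers are quotients of a common C*-cover. -/
theorem exists_common_cover {C : Type u} [CStarAlgebra C] {X : Submodule ℂ C}
    (hC : Generates (X : Set C)) {B : Type v} [CStarAlgebra B] {j : X →ₗ[ℂ] B}
    (hj : IsCStarCover X j) :
    ∃ (D : Type (max u v)) (_ : CStarAlgebra D) (k : X →ₗ[ℂ] D) (p : D →⋆ₐ[ℂ] C)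
      (q : D →⋆ₐ[ℂ] B), IsUCIS X k ∧ Generates (LinearMap.range k : Set D) ∧
        Function.Surjective p ∧ Function.Surjective q ∧ (∀ x, p (k x) = x) ∧
        ∀ x, q (k x) = j x := by
  -- The common cover is generated by the graph of `j`; the matrix norm there is the maximum of two
  -- equal norms.
  let G : Set (C × B) := Set.range fun x : X => ((x : C), j x)
  let D : StarSubalgebra ℂ (C × B) := (StarAlgebra.adjoin ℂ G).topologicalClosure
  have : IsClosed (D : Set (C × B)) := StarSubalgebra.isClosed_topologicalClosure _
  have hG : G ⊆ D := fun g hg =>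
    StarSubalgebra.le_topologicalClosure _ (StarAlgebra.subset_adjoin ℂ G hg)
  let k : X →ₗ[ℂ] D :=
    { toFun := fun x => ⟨((x : C), j x), hG ⟨x, rfl⟩⟩
      map_add' := fun x y => Subtype.ext (Prod.ext rfl (map_add j x y))
      map_smul' := fun z x => Subtype.ext (Prod.ext rfl (map_smul j z x)) }
  let p : D →⋆ₐ[ℂ] C := (StarAlgHom.fst ℂ C B).comp D.subtype
  let q : D →⋆ₐ[ℂ] B := (StarAlgHom.snd ℂ C B).comp D.subtype
  refine ⟨D, inferInstance, k, p, q, ⟨fun e he => ?_, fun n M => ?_⟩, ?_, ?_, ?_, fun x => rfl,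
    fun x => rfl⟩
  · exact Subtype.ext (Prod.ext he (hj.ucis.map_one e he))
  · rw [← matrixNorm_map_of_injective (D.subtype : D →⋆ₙₐ[ℂ] C × B) Subtype.val_injective,
      matrixNorm_prod]
    have h1 := hj.ucis.isometric n M
    exact (congrArg (max _) h1).trans (max_self _)
  · rw [Generates, eq_top_iff]
    rintro d -
    have h1 : (D.subtype : D →⋆ₐ[ℂ] C × B) '' (LinearMap.range k : Set D) = G := by
      rw [LinearMap.coe_range, ← Set.range_comp]
      rfl
    have h2 := StarAlgHom.map_adjoin D.subtype (LinearMap.range k : Set D)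
    rw [h1] at h2
    have h3 : (d : C × B) ∈ closure (StarAlgebra.adjoin ℂ G : Set (C × B)) := d.2
    rw [← h2] at h3
    have h4 : d ∈ closure (StarAlgebra.adjoin ℂ (LinearMap.range k : Set D) : Set D) := by
      rw [Topology.IsInducing.subtypeVal.closure_eq_preimage_closure_image]
      exact h3
    exact h4
  · refine surjective_of_generates p hC fun x hx => ⟨k ⟨x, hx⟩, rfl⟩
  · refine surjective_of_generates q hj.generates ?_
    rintro _ ⟨x, rfl⟩
    exact ⟨k x, rfl⟩

/-- The quotient by the Šilov ideal is the C*-envelope. -/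
theorem IsSilovIdeal.isCStarEnvelope {C : Type u} [CStarAlgebra C] {X : Submodule ℂ C}
    (hX : IsUnital X) (hC : Generates (X : Set C)) {I : Ideal C} [I.IsTwoSided]
    [IsClosed (I : Set C)] (hI : IsSilovIdeal X I) :
    IsCStarEnvelope.{v} X (quotientMap X I) where
  isCover :=
    { ucis := by
        obtain ⟨_, _, h⟩ := hI.1
        exact h
      generates := by
        have := generates_image (CStarQuotient.mk I) Ideal.Quotient.mk_surjective hC
        convert this
        ext y
        simp [quotientMap] }
  existsUnique_epi B _ j hj := by
    obtain ⟨D, _, k, p, q, hk, hD, hp, hq, hpk, hqk⟩ := exists_common_cover hC hj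
    have hD1 : IsUnital (LinearMap.range k) := ⟨⟨1, hX⟩, hk.map_one _ rfl⟩
    obtain ⟨I', hI'2, hI'c, hI'⟩ := exists_isSilovIdeal hD1 hD
    have hpk' : p.toAlgHom.toLinearMap ∘ₗ k = X.subtype := LinearMap.ext hpk
    have hqk' : q.toAlgHom.toLinearMap ∘ₗ k = j := LinearMap.ext hqk
    have hkerp : RingHom.ker p ≤ I' := hI'.2 <| isBoundaryIdeal_ker p <|
      hk.range_of_comp hX (by rw [hpk']; exact ⟨fun _ he => he, fun _ _ => rfl⟩)
    have hkerq : RingHom.ker q ≤ I' := hI'.2 <| isBoundaryIdeal_ker q <|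
      hk.range_of_comp hX (by rw [hqk']; exact hj.ucis)
    obtain ⟨σ, hσ⟩ := exists_factor p hp (CStarQuotient.mk I') fun d hd =>
      Ideal.Quotient.eq_zero_iff_mem.2 (hkerp hd)
    -- `σ : C → D/I'` restricts on `X` to `q_{I'} ∘ k`, a complete isometry, so its kernel is a
    -- boundary ideal of `C`.
    have hkerσ : RingHom.ker σ ≤ I := by
      refine hI.2 (isBoundaryIdeal_ker σ ?_)
      obtain ⟨_, _, h⟩ := hI'.1
      have h1 := hk.comp_range (f := (CStarQuotient.mk I').toAlgHom.toLinearMap) h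
      convert h1 using 1
      ext x
      exact (congrArg σ (hpk x)).symm.trans (hσ (k x))
    -- If `q d = 0` then `d ∈ I'`, so `σ(p d) = 0` and `p d ∈ I`; hence `q_I ∘ p` factors through
    -- `q`.
    obtain ⟨Φ, hΦ⟩ := exists_factor q hq ((CStarQuotient.mk I).comp p) fun d hd => by
      refine Ideal.Quotient.eq_zero_iff_mem.2 (hkerσ ?_)
      exact (hσ d).trans (Ideal.Quotient.eq_zero_iff_mem.2 (hkerq hd))
    have hΦj : ∀ x, Φ (j x) = quotientMap X I x := fun x => by
      rw [← hqk, hΦ, StarAlgHom.comp_apply, hpk]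
      rfl
    refine ⟨Φ, ⟨fun y => ?_, hΦj⟩, fun Ψ hΨ => eq_of_generates hj.generates ?_⟩
    · obtain ⟨c, rfl⟩ := Ideal.Quotient.mk_surjective y
      obtain ⟨d, rfl⟩ := hp c
      exact ⟨q d, hΦ d⟩
    · rintro _ ⟨x, rfl⟩
      rw [hΨ.2, hΦj]

end Covers

end OperatorSpace

end

theorem mainTheorem1 {C : Type u} [CStarAlgebra C] (X : Submodule ℂ C)
    (hX : OperatorSpace.IsUnital X) (hC : OperatorSpace.Generates (X : Set C)) :
    ∃ (I : Ideal C) (_ : I.IsTwoSided) (_ : IsClosed (I : Set C)),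
      OperatorSpace.IsSilovIdeal X I ∧
        OperatorSpace.IsCStarEnvelope.{v} X (OperatorSpace.quotientMap X I) := by
  obtain ⟨I, h2, hc, hI⟩ := OperatorSpace.exists_isSilovIdeal hX hC
  exact ⟨I, h2, hc, hI, hI.isCStarEnvelope hX hC⟩
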